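/- Let $K$ be a field of characteristic different from $2$ and $3$. For a finite-dimensional Lie superalgebra $L=L_{\bar 0}\oplus L_{\bar 1}$ over $K$ of superdimension $(m\mid n)$ (that is, $\dim L_{\bar 0}=m$ and $\dim L_{\bar 1}=n$), write $L^2=[L,L]$ for its derived subsuperalgebra, and call $L$ nilpotent if its lower central series $C^0(L)=L$, $C^{i+1}(L)=[L,C^i(L)]$ reaches $0$. For a free presentation $L\cong F/R$, with $F$ a free Lie superalgebra on a set of even and odd generators, let $\mathcal{M}(L)=(R\cap F^2)/[R,F]$ be the Schur multiplier of $L$; up to isomorphism it does not depend on the presentation. Then there is no nilpotent Lie superalgebra $L$ over $K$ of superdimension $(m\mid n)$ with $m+n=6$ and $n\ge 1$ such that $\dim L^2=4$ and $\dim\mathcal{M}(L)=m+2n-4$. -/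

import Mathlib

universe u v w

/-- The Koszul sign `(-1)^(i j)` attached to two parities `i, j ∈ ℤ/2`. -/
def koszulSign (K : Type u) [Field K] (i j : ZMod 2) : K :=
  (-1) ^ (i.val * j.val)

/-- A Lie superalgebra over a field `K` (of characteristic different from `2` and `3`): a vector
space `L = L₀ ⊕ L₁` graded by `ℤ/2`, with a bilinear bracket of degree zero which satisfies the
graded skew-symmetry and the graded Jacobi identity. -/
class LieSuperalgebra (K : Type u) (L : Type v) [Field K] [AddCommGroup L] [Module K L] where
  /-- The homogeneous components: `grade 0 = L₀` (even part), `grade 1 = L₁` (odd part). -/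
  grade : ZMod 2 → Submodule K L
  isCompl_grade : IsCompl (grade 0) (grade 1)
  /-- The bracket `[x, y]`. -/
  bracket : L →ₗ[K] L →ₗ[K] L
  bracket_mem : ∀ {i j : ZMod 2} {x y : L}, x ∈ grade i → y ∈ grade j →
    bracket x y ∈ grade (i + j)
  bracket_skew : ∀ {i j : ZMod 2} {x y : L}, x ∈ grade i → y ∈ grade j →
    bracket x y = -(koszulSign K i j • bracket y x)
  bracket_jacobi : ∀ {i j : ZMod 2} {x y : L}, x ∈ grade i → y ∈ grade j → ∀ z : L,
    bracket x (bracket y z) =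
      bracket (bracket x y) z + koszulSign K i j • bracket y (bracket x z)

namespace LieSuperalgebra

section Basic

variable (K : Type u) (L : Type v) [Field K] [AddCommGroup L] [Module K L] [LieSuperalgebra K L]

/-- `[S, T]`: the span of all brackets `[s, t]` with `s ∈ S` and `t ∈ T`. -/
def bracketSpan (S T : Submodule K L) : Submodule K L :=
  Submodule.span K {z | ∃ s ∈ S, ∃ t ∈ T, bracket (K := K) s t = z}

/-- The derived subsuperalgebra `L² = [L, L]`. -/
def derived : Submodule K L := bracketSpan K L ⊤ ⊤

/-- The lower central series `C⁰(L) = L`, `Cⁱ⁺¹(L) = [L, Cⁱ(L)]`. -/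
def lowerCentral : ℕ → Submodule K L
  | 0 => ⊤
  | i + 1 => bracketSpan K L ⊤ (lowerCentral i)

/-- `L` is nilpotent if some term of its lower central series vanishes. -/
def IsNilpotent : Prop := ∃ k : ℕ, lowerCentral K L k = ⊥

/-- `L` is a finite-dimensional Lie superalgebra of superdimension `(m | n)`. -/
def HasSuperdim (m n : ℕ) : Prop :=
  FiniteDimensional K L ∧
    Module.finrank K (grade (K := K) (L := L) 0) = m ∧
    Module.finrank K (grade (K := K) (L := L) 1) = n

end Basic

end LieSuperalgebra

/-! ### The free Lie superalgebra on a set of generators with prescribed parities -/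

namespace FreeLieSuper

section Construction

variable (K : Type u) [Field K] {X : Type w} (p : X → ZMod 2)

/-- The parity of a nonassociative monomial: the sum of the parities of its letters. -/
def parity : FreeMagma X → ZMod 2
  | FreeMagma.of x => p x
  | FreeMagma.mul a b => parity a + parity b

/-- The monomial `a`, as an element of the free nonassociative algebra on `X`. -/
noncomputable def mon (a : FreeMagma X) : FreeNonUnitalNonAssocAlgebra K X :=
  MonoidAlgebra.single a 1

/-- The graded skew-symmetry and graded Jacobi relators on monomials, closed under multiplication
by monomials from both sides. -/
inductive IsRelator : FreeNonUnitalNonAssocAlgebra K X → Prop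
  | skew (a b : FreeMagma X) :
      IsRelator (mon K a * mon K b
        + koszulSign K (parity p a) (parity p b) • (mon K b * mon K a))
  | jacobi (a b c : FreeMagma X) :
      IsRelator (mon K a * (mon K b * mon K c) - (mon K a * mon K b) * mon K c
        - koszulSign K (parity p a) (parity p b) • (mon K b * (mon K a * mon K c)))
  | mul_left (a : FreeMagma X) {r : FreeNonUnitalNonAssocAlgebra K X} :
      IsRelator r → IsRelator (mon K a * r)
  | mul_right (a : FreeMagma X) {r : FreeNonUnitalNonAssocAlgebra K X} :
      IsRelator r → IsRelator (r * mon K a)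

/-- The two-sided ideal generated by the relators. -/
noncomputable def relIdeal : Submodule K (FreeNonUnitalNonAssocAlgebra K X) :=
  Submodule.span K {r | IsRelator K p r}

end Construction

end FreeLieSuper

/-- The free Lie superalgebra over `K` on the set `X`, where the generator `x` has parity `p x`:
the free nonassociative algebra on `X` modulo the ideal generated by the graded skew-symmetry and
graded Jacobi relators. -/
abbrev FreeLieSuper (K : Type u) [Field K] {X : Type w} (p : X → ZMod 2) : Type (max u w) :=
  FreeNonUnitalNonAssocAlgebra K X ⧸ FreeLieSuper.relIdeal K p

namespace FreeLieSuper

section Structure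

variable (K : Type u) [Field K] {X : Type w} (p : X → ZMod 2)

/-- The homogeneous components of the free nonassociative algebra. -/
noncomputable def magmaGrade (i : ZMod 2) : Submodule K (FreeNonUnitalNonAssocAlgebra K X) :=
  Submodule.span K {r | ∃ a : FreeMagma X, parity p a = i ∧ mon K a = r}

theorem mon_mul_mon (a b : FreeMagma X) : mon K a * mon K b = mon K (a * b) := by
  simp [mon]

theorem parity_mul (a b : FreeMagma X) : parity p (a * b) = parity p a + parity p b := rfl

theorem span_mon : Submodule.span K (Set.range (mon K (X := X))) = ⊤ := by
  rw [eq_top_iff]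
  rintro x -
  induction x using MonoidAlgebra.induction_linear with
  | zero => exact zero_mem _
  | add x y hx hy => exact add_mem hx hy
  | single a r =>
    have h : (MonoidAlgebra.single a r : FreeNonUnitalNonAssocAlgebra K X) = r • mon K a := by
      simp [mon]
    rw [h]
    exact Submodule.smul_mem _ _ (Submodule.subset_span ⟨a, rfl⟩)

theorem mul_mem_left (x : FreeNonUnitalNonAssocAlgebra K X) {r : FreeNonUnitalNonAssocAlgebra K X}
    (hr : r ∈ relIdeal K p) : x * r ∈ relIdeal K p := by
  have hx : x ∈ Submodule.span K (Set.range (mon K (X := X))) := by rw [span_mon]; trivial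
  induction hx using Submodule.span_induction with
  | mem x h =>
    obtain ⟨a, rfl⟩ := h
    induction hr using Submodule.span_induction with
    | mem r h => exact Submodule.subset_span (IsRelator.mul_left a h)
    | zero => simp
    | add y z _ _ hy hz => rw [mul_add]; exact add_mem hy hz
    | smul t y _ hy => rw [mul_smul_comm]; exact Submodule.smul_mem _ _ hy
  | zero => simp
  | add y z _ _ hy hz => rw [add_mul]; exact add_mem hy hz
  | smul t y _ hy => rw [smul_mul_assoc]; exact Submodule.smul_mem _ _ hy

theorem mul_mem_right (x : FreeNonUnitalNonAssocAlgebra K X) {r : FreeNonUnitalNonAssocAlgebra K X}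
    (hr : r ∈ relIdeal K p) : r * x ∈ relIdeal K p := by
  have hx : x ∈ Submodule.span K (Set.range (mon K (X := X))) := by rw [span_mon]; trivial
  induction hx using Submodule.span_induction with
  | mem x h =>
    obtain ⟨a, rfl⟩ := h
    induction hr using Submodule.span_induction with
    | mem r h => exact Submodule.subset_span (IsRelator.mul_right a h)
    | zero => simp
    | add y z _ _ hy hz => rw [add_mul]; exact add_mem hy hz
    | smul t y _ hy => rw [smul_mul_assoc]; exact Submodule.smul_mem _ _ hy
  | zero => simp
  | add y z _ _ hy hz => rw [mul_add]; exact add_mem hy hz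
  | smul t y _ hy => rw [mul_smul_comm]; exact Submodule.smul_mem _ _ hy

/-- The bracket of the free Lie superalgebra, induced by the multiplication. -/
noncomputable def bracketHom : FreeLieSuper K p →ₗ[K] FreeLieSuper K p →ₗ[K] FreeLieSuper K p :=
  Submodule.liftQ (relIdeal K p)
    { toFun := fun x => Submodule.mapQ (relIdeal K p) (relIdeal K p) (LinearMap.mul K _ x)
        fun _ hr => mul_mem_left K p x hr
      map_add' := fun x y => by
        apply Submodule.linearMap_qext
        apply LinearMap.ext
        intro z
        exact congrArg (relIdeal K p).mkQ (add_mul x y z)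
      map_smul' := fun t x => by
        apply Submodule.linearMap_qext
        apply LinearMap.ext
        intro z
        exact congrArg (relIdeal K p).mkQ (smul_mul_assoc t x z) }
    (by
      intro r hr
      rw [LinearMap.mem_ker]
      apply Submodule.linearMap_qext
      apply LinearMap.ext
      intro z
      exact (Submodule.Quotient.mk_eq_zero _).mpr (mul_mem_right K p z hr))

theorem bracketHom_mk (x y : FreeNonUnitalNonAssocAlgebra K X) :
    bracketHom K p ((relIdeal K p).mkQ x) ((relIdeal K p).mkQ y) = (relIdeal K p).mkQ (x * y) :=
  rfl

/-- The projection of the free nonassociative algebra to its component of parity `i`. -/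
noncomputable def proj (i : ZMod 2) :
    FreeNonUnitalNonAssocAlgebra K X →ₗ[K] FreeNonUnitalNonAssocAlgebra K X :=
  (Finsupp.linearCombination K fun a : FreeMagma X => if parity p a = i then mon K a else 0) ∘ₗ
    (MonoidAlgebra.coeffLinearEquiv K).toLinearMap

theorem proj_mon (i : ZMod 2) (a : FreeMagma X) :
    proj K p i (mon K a) = if parity p a = i then mon K a else 0 := by
  simp [proj, mon]

theorem proj_of_mem {i : ZMod 2} (j : ZMod 2) {x : FreeNonUnitalNonAssocAlgebra K X}
    (hx : x ∈ magmaGrade K p i) : proj K p j x = if i = j then x else 0 := by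
  induction hx using Submodule.span_induction with
  | mem x h => obtain ⟨a, rfl, rfl⟩ := h; exact proj_mon K p j a
  | zero => simp
  | add y z _ _ hy hz => rw [map_add, hy, hz]; split_ifs <;> simp
  | smul t y _ hy => rw [map_smul, hy]; split_ifs <;> simp

theorem mon_mem (a : FreeMagma X) : mon K a ∈ magmaGrade K p (parity p a) :=
  Submodule.subset_span ⟨a, rfl, rfl⟩

theorem mul_mem_grade {i j : ZMod 2} {x y : FreeNonUnitalNonAssocAlgebra K X}
    (hx : x ∈ magmaGrade K p i) (hy : y ∈ magmaGrade K p j) :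
    x * y ∈ magmaGrade K p (i + j) := by
  induction hx using Submodule.span_induction with
  | mem x h =>
    obtain ⟨a, rfl, rfl⟩ := h
    induction hy using Submodule.span_induction with
    | mem y h =>
      obtain ⟨b, rfl, rfl⟩ := h
      rw [mon_mul_mon]
      exact mon_mem K p (a * b)
    | zero => simp
    | add y z _ _ hy hz => rw [mul_add]; exact add_mem hy hz
    | smul t y _ hy => rw [mul_smul_comm]; exact Submodule.smul_mem _ _ hy
  | zero => simp
  | add y z _ _ hy hz => rw [add_mul]; exact add_mem hy hz
  | smul t y _ hy => rw [smul_mul_assoc]; exact Submodule.smul_mem _ _ hy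

theorem isRelator_homogeneous {r : FreeNonUnitalNonAssocAlgebra K X} (hr : IsRelator K p r) :
    ∃ i, r ∈ magmaGrade K p i := by
  induction hr with
  | skew a b =>
    refine ⟨parity p a + parity p b, add_mem (mul_mem_grade K p (mon_mem K p a) (mon_mem K p b))
      (Submodule.smul_mem _ _ ?_)⟩
    rw [add_comm]
    exact mul_mem_grade K p (mon_mem K p b) (mon_mem K p a)
  | jacobi a b c =>
    have ha := mon_mem K p a
    have hb := mon_mem K p b
    have hc := mon_mem K p c
    refine ⟨parity p a + (parity p b + parity p c), sub_mem (sub_mem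
      (mul_mem_grade K p ha (mul_mem_grade K p hb hc)) ?_) (Submodule.smul_mem _ _ ?_)⟩
    · rw [← add_assoc]
      exact mul_mem_grade K p (mul_mem_grade K p ha hb) hc
    · rw [add_left_comm]
      exact mul_mem_grade K p hb (mul_mem_grade K p ha hc)
  | mul_left a _ ih => obtain ⟨i, hi⟩ := ih; exact ⟨_, mul_mem_grade K p (mon_mem K p a) hi⟩
  | mul_right a _ ih => obtain ⟨i, hi⟩ := ih; exact ⟨_, mul_mem_grade K p hi (mon_mem K p a)⟩

theorem proj_mem_relIdeal (j : ZMod 2) {r : FreeNonUnitalNonAssocAlgebra K X}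
    (hr : r ∈ relIdeal K p) : proj K p j r ∈ relIdeal K p := by
  induction hr using Submodule.span_induction with
  | mem r h =>
    obtain ⟨i, hi⟩ := isRelator_homogeneous K p h
    rw [proj_of_mem K p j hi]
    split_ifs
    · exact Submodule.subset_span h
    · exact zero_mem _
  | zero => simp
  | add y z _ _ hy hz => rw [map_add]; exact add_mem hy hz
  | smul t y _ hy => rw [map_smul]; exact Submodule.smul_mem _ _ hy

theorem isCompl_map_magmaGrade :
    IsCompl ((magmaGrade K p 0).map (relIdeal K p).mkQ)
      ((magmaGrade K p 1).map (relIdeal K p).mkQ) := by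
  constructor
  · rw [Submodule.disjoint_def]
    rintro _ ⟨x, hx, rfl⟩ ⟨y, hy, hxy⟩
    have h : y - x ∈ relIdeal K p := by
      rw [← Submodule.ker_mkQ (relIdeal K p), LinearMap.mem_ker, map_sub, hxy, sub_self]
    have h' := proj_mem_relIdeal K p 0 h
    rw [map_sub, proj_of_mem K p 0 hx, proj_of_mem K p 0 hy, if_pos rfl,
      if_neg (by decide), zero_sub, neg_mem_iff] at h'
    simpa using h'
  · rw [codisjoint_iff, ← Submodule.map_sup, eq_top_iff, ← Submodule.range_mkQ (relIdeal K p),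
      LinearMap.range_eq_map]
    apply Submodule.map_mono
    rw [← span_mon K, Submodule.span_le]
    rintro _ ⟨a, rfl⟩
    have h01 : ∀ i : ZMod 2, i = 0 ∨ i = 1 := by decide
    have ha := mon_mem K p a
    rcases h01 (parity p a) with h | h <;> rw [h] at ha
    · exact Submodule.mem_sup_left ha
    · exact Submodule.mem_sup_right ha

theorem skew_mem {i j : ZMod 2} {x y : FreeNonUnitalNonAssocAlgebra K X}
    (hx : x ∈ magmaGrade K p i) (hy : y ∈ magmaGrade K p j) :
    x * y + koszulSign K i j • (y * x) ∈ relIdeal K p := by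
  induction hx using Submodule.span_induction with
  | mem x h =>
    obtain ⟨a, rfl, rfl⟩ := h
    induction hy using Submodule.span_induction with
    | mem y h => obtain ⟨b, rfl, rfl⟩ := h; exact Submodule.subset_span (IsRelator.skew a b)
    | zero => simp
    | add y z _ _ hy hz =>
      convert add_mem hy hz using 1
      simp only [mul_add, add_mul, smul_add]; abel
    | smul t y _ hy =>
      convert Submodule.smul_mem _ t hy using 1
      simp only [mul_smul_comm, smul_mul_assoc, smul_add, smul_comm t]
  | zero => simp
  | add y z _ _ hy hz =>
    convert add_mem hy hz using 1
    simp only [mul_add, add_mul, smul_add]; abel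
  | smul t y _ hy =>
    convert Submodule.smul_mem _ t hy using 1
    simp only [mul_smul_comm, smul_mul_assoc, smul_add, smul_comm t]

theorem jacobi_mem {i j : ZMod 2} {x y : FreeNonUnitalNonAssocAlgebra K X}
    (hx : x ∈ magmaGrade K p i) (hy : y ∈ magmaGrade K p j)
    (z : FreeNonUnitalNonAssocAlgebra K X) :
    x * (y * z) - (x * y) * z - koszulSign K i j • (y * (x * z)) ∈ relIdeal K p := by
  have hz : z ∈ Submodule.span K (Set.range (mon K (X := X))) := by rw [span_mon]; trivial
  induction hx using Submodule.span_induction with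
  | mem x h =>
    obtain ⟨a, rfl, rfl⟩ := h
    induction hy using Submodule.span_induction with
    | mem y h =>
      obtain ⟨b, rfl, rfl⟩ := h
      induction hz using Submodule.span_induction with
      | mem z h => obtain ⟨c, rfl⟩ := h; exact Submodule.subset_span (IsRelator.jacobi a b c)
      | zero => simp
      | add y z _ _ hy hz =>
        convert add_mem hy hz using 1
        simp only [mul_add, smul_add]; abel
      | smul t y _ hy =>
        convert Submodule.smul_mem _ t hy using 1
        simp only [mul_smul_comm, smul_sub, smul_comm t]
    | zero => simp
    | add y z _ _ hy hz =>
      convert add_mem hy hz using 1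
      simp only [mul_add, add_mul, smul_add]; abel
    | smul t y _ hy =>
      convert Submodule.smul_mem _ t hy using 1
      simp only [mul_smul_comm, smul_mul_assoc, smul_sub, smul_comm t]
  | zero => simp
  | add y z _ _ hy hz =>
    convert add_mem hy hz using 1
    simp only [mul_add, add_mul, smul_add]; abel
  | smul t y _ hy =>
    convert Submodule.smul_mem _ t hy using 1
    simp only [mul_smul_comm, smul_mul_assoc, smul_sub, smul_comm t]

noncomputable instance : LieSuperalgebra K (FreeLieSuper K p) where
  grade i := (magmaGrade K p i).map (relIdeal K p).mkQ
  isCompl_grade := isCompl_map_magmaGrade K p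
  bracket := bracketHom K p
  bracket_mem := by
    rintro i j _ _ ⟨x, hx, rfl⟩ ⟨y, hy, rfl⟩
    exact ⟨x * y, mul_mem_grade K p hx hy, rfl⟩
  bracket_skew := by
    rintro i j _ _ ⟨x, hx, rfl⟩ ⟨y, hy, rfl⟩
    rw [bracketHom_mk, bracketHom_mk, eq_neg_iff_add_eq_zero, ← map_smul, ← map_add,
      ← LinearMap.mem_ker, Submodule.ker_mkQ]
    exact skew_mem K p hx hy
  bracket_jacobi := by
    rintro i j _ _ ⟨x, hx, rfl⟩ ⟨y, hy, rfl⟩ z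
    obtain ⟨z, rfl⟩ := (relIdeal K p).mkQ_surjective z
    simp only [bracketHom_mk]
    rw [← sub_eq_zero, ← sub_sub, ← map_smul, ← map_sub, ← map_sub,
      ← LinearMap.mem_ker, Submodule.ker_mkQ]
    exact jacobi_mem K p hx hy z

/-- The generator of the free Lie superalgebra attached to `x : X`. -/
noncomputable def ι (x : X) : FreeLieSuper K p :=
  (relIdeal K p).mkQ (FreeNonUnitalNonAssocAlgebra.of K x)

theorem ι_mem (x : X) : ι K p x ∈ LieSuperalgebra.grade (K := K) (p x) :=
  ⟨_, mon_mem K p (FreeMagma.of x), rfl⟩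

end Structure

section Lift

open LieSuperalgebra

variable {K : Type u} [Field K] {X : Type w} {p : X → ZMod 2}
  {L : Type v} [AddCommGroup L] [Module K L] [LieSuperalgebra K L]

/-- The value in `L` of a nonassociative monomial. -/
def evalMon (K : Type u) [Field K] {L : Type v} [AddCommGroup L] [Module K L]
    [LieSuperalgebra K L] (φ : X → L) : FreeMagma X → L
  | FreeMagma.of x => φ x
  | FreeMagma.mul a b => bracket (K := K) (evalMon K φ a) (evalMon K φ b)

/-- The linear extension of `evalMon` to the free nonassociative algebra. -/
noncomputable def evalHom (K : Type u) [Field K] {L : Type v} [AddCommGroup L] [Module K L]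
    [LieSuperalgebra K L] (φ : X → L) : FreeNonUnitalNonAssocAlgebra K X →ₗ[K] L :=
  Finsupp.linearCombination K (evalMon K φ) ∘ₗ (MonoidAlgebra.coeffLinearEquiv K).toLinearMap

theorem evalHom_mon (φ : X → L) (a : FreeMagma X) : evalHom K φ (mon K a) = evalMon K φ a := by
  simp [evalHom, mon]

theorem evalHom_mul (φ : X → L) (x y : FreeNonUnitalNonAssocAlgebra K X) :
    evalHom K φ (x * y) = bracket (K := K) (evalHom K φ x) (evalHom K φ y) := by
  have hx : x ∈ Submodule.span K (Set.range (mon K (X := X))) := by rw [span_mon]; trivial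
  have hy : y ∈ Submodule.span K (Set.range (mon K (X := X))) := by rw [span_mon]; trivial
  induction hx using Submodule.span_induction with
  | mem x h =>
    obtain ⟨a, rfl⟩ := h
    induction hy using Submodule.span_induction with
    | mem y h =>
      obtain ⟨b, rfl⟩ := h
      rw [mon_mul_mon, evalHom_mon, evalHom_mon, evalHom_mon]
      rfl
    | zero => simp
    | add y z _ _ hy hz => rw [mul_add, map_add, hy, hz, map_add, map_add]
    | smul t y _ hy => rw [mul_smul_comm, map_smul, hy, map_smul, map_smul]
  | zero => simp
  | add y z _ _ hy hz => rw [add_mul, map_add, hy, hz, map_add, map_add, LinearMap.add_apply]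
  | smul t y _ hy => rw [smul_mul_assoc, map_smul, hy, map_smul, map_smul, LinearMap.smul_apply]

theorem evalMon_mem {φ : X → L} (hφ : ∀ x, φ x ∈ grade (K := K) (p x)) (a : FreeMagma X) :
    evalMon K φ a ∈ grade (K := K) (L := L) (parity p a) := by
  induction a using FreeMagma.recOnMul with
  | ih1 x => exact hφ x
  | ih2 a b ha hb => exact bracket_mem ha hb

theorem relIdeal_le_ker {φ : X → L} (hφ : ∀ x, φ x ∈ grade (K := K) (p x)) :
    relIdeal K p ≤ LinearMap.ker (evalHom K φ) := by
  rw [relIdeal, Submodule.span_le]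
  intro r hr
  rw [SetLike.mem_coe, LinearMap.mem_ker]
  induction hr with
  | skew a b =>
    rw [map_add, map_smul, evalHom_mul, evalHom_mul, evalHom_mon, evalHom_mon,
      bracket_skew (evalMon_mem hφ a) (evalMon_mem hφ b), neg_add_cancel]
  | jacobi a b c =>
    simp only [map_sub, map_smul, evalHom_mul, evalHom_mon]
    rw [bracket_jacobi (evalMon_mem hφ a) (evalMon_mem hφ b)]
    abel
  | mul_left a _ ih => rw [evalHom_mul, ih, map_zero]
  | mul_right a _ ih => rw [evalHom_mul, ih, map_zero, LinearMap.zero_apply]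

/-- The homomorphism of Lie superalgebras from the free Lie superalgebra to `L` which extends a
parity-preserving map `φ` on the generators. -/
noncomputable def lift (φ : X → L) (hφ : ∀ x, φ x ∈ grade (K := K) (p x)) :
    FreeLieSuper K p →ₗ[K] L :=
  (relIdeal K p).liftQ (evalHom K φ) (relIdeal_le_ker hφ)

theorem lift_ι (φ : X → L) (hφ : ∀ x, φ x ∈ grade (K := K) (p x)) (x : X) :
    lift φ hφ (ι K p x) = φ x :=
  evalHom_mon φ (FreeMagma.of x)

theorem lift_bracket (φ : X → L) (hφ : ∀ x, φ x ∈ grade (K := K) (p x))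
    (a b : FreeLieSuper K p) :
    lift φ hφ (bracket (K := K) a b) = bracket (K := K) (lift φ hφ a) (lift φ hφ b) := by
  obtain ⟨a, rfl⟩ := (relIdeal K p).mkQ_surjective a
  obtain ⟨b, rfl⟩ := (relIdeal K p).mkQ_surjective b
  exact evalHom_mul φ a b

/-- A bracket-preserving linear map on the free Lie superalgebra is determined by its values on
the generators. -/
theorem lift_unique (φ : X → L) (hφ : ∀ x, φ x ∈ grade (K := K) (p x))
    (g : FreeLieSuper K p →ₗ[K] L)
    (hg : ∀ a b, g (bracket (K := K) a b) = bracket (K := K) (g a) (g b))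
    (hι : ∀ x, g (ι K p x) = φ x) : g = lift φ hφ := by
  apply Submodule.linearMap_qext
  apply LinearMap.ext_on_range (span_mon K (X := X))
  intro a
  induction a using FreeMagma.recOnMul with
  | ih1 x => exact (hι x).trans (lift_ι φ hφ x).symm
  | ih2 a b ha hb =>
    rw [← mon_mul_mon]
    simp only [LinearMap.comp_apply, ← bracketHom_mk] at ha hb ⊢
    exact (hg _ _).trans (by rw [ha, hb]; exact (lift_bracket φ hφ _ _).symm)

end Lift

end FreeLieSuper

namespace LieSuperalgebra

section Multiplier

variable (K : Type u) (L : Type v) [Field K] [AddCommGroup L] [Module K L] [LieSuperalgebra K L]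

/-- A free presentation `L ≅ F / R` of a Lie superalgebra `L`: a set `gen` of generators with
parities, and a parity-preserving map from `gen` to `L` such that the induced homomorphism from the
free Lie superalgebra `F` on `gen` to `L` is surjective. -/
structure FreePresentation where
  /-- The set of generators of `F`. -/
  gen : Type w
  /-- The parities of the generators. -/
  par : gen → ZMod 2
  /-- The images of the generators in `L`. -/
  toFun : gen → L
  toFun_mem : ∀ x, toFun x ∈ grade (K := K) (par x)
  surjective : Function.Surjective (FreeLieSuper.lift toFun toFun_mem)

namespace FreePresentation

variable {K L}

/-- The free Lie superalgebra `F` of the presentation `L ≅ F / R`. -/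
abbrev F (P : FreePresentation.{u, v, w} K L) : Type (max u w) := FreeLieSuper K P.par

/-- The kernel `R` of the presentation `L ≅ F / R`. -/
noncomputable def R (P : FreePresentation.{u, v, w} K L) : Submodule K P.F :=
  LinearMap.ker (FreeLieSuper.lift P.toFun P.toFun_mem)

/-- The Schur multiplier `(R ∩ F²) / [R, F]` of `L ≅ F / R`. -/
abbrev SchurMultiplier (P : FreePresentation.{u, v, w} K L) : Type (max u w) :=
  ↥(P.R ⊓ derived K P.F) ⧸ (bracketSpan K P.F P.R ⊤).submoduleOf (P.R ⊓ derived K P.F)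

/-- The submodule `[R, F]` is contained in `R ∩ F²`. -/
theorem bracketSpan_le (P : FreePresentation.{u, v, w} K L) :
    bracketSpan K P.F P.R ⊤ ≤ P.R ⊓ derived K P.F := by
  rw [bracketSpan, Submodule.span_le]
  rintro _ ⟨r, hr, x, -, rfl⟩
  refine ⟨?_, Submodule.subset_span ⟨r, trivial, x, trivial, rfl⟩⟩
  have hr' : FreeLieSuper.lift P.toFun P.toFun_mem r = 0 := hr
  change FreeLieSuper.lift P.toFun P.toFun_mem _ = 0
  rw [FreeLieSuper.lift_bracket, hr', map_zero, LinearMap.zero_apply]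

end FreePresentation

/-- Every Lie superalgebra has a free presentation: take all homogeneous elements as generators. -/
noncomputable def canonicalPresentation : FreePresentation.{u, v, v} K L where
  gen := Σ i : ZMod 2, grade (K := K) (L := L) i
  par := Sigma.fst
  toFun x := x.2
  toFun_mem x := x.2.2
  surjective := by
    intro z
    have hz : z ∈ grade (K := K) (L := L) 0 ⊔ grade (K := K) (L := L) 1 := by
      rw [isCompl_grade.sup_eq_top]; trivial
    obtain ⟨a, ha, b, hb, rfl⟩ := Submodule.mem_sup.mp hz
    refine ⟨FreeLieSuper.ι K _ ⟨0, a, ha⟩ + FreeLieSuper.ι K _ ⟨1, b, hb⟩, ?_⟩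
    rw [map_add, FreeLieSuper.lift_ι, FreeLieSuper.lift_ι]

end Multiplier

end LieSuperalgebra

namespace LieSuperalgebra

/-! Since `m + n = 6`, the excluded value of `dim M(L)` is `n + 2`, so it suffices to prove `dim
M(L) < n + 2`. As `dim L/L² = 2`, nilpotency makes `L` generated by two homogeneous elements. They
are not both even, since otherwise `L` would have no odd part.

The upper bound comes from `F²/[R, F]`, which is an extension of `L²` by `M(L)`. If `L` has
nilpotency class at most `k`, then `C^k(F) ⊆ R` and `C^(k+1)(F) ⊆ [R, F]`. Hence `F²/[R, F]` is
spanned by the brackets of lifted generators with each other and with lifts of a spanning set of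
`L²`. Counting those brackets after removing the ones that are redundant by the Jacobi identity, or
modulo `[R, F]`, bounds `dim M(L) + dim L²` (`rank_multiplier_add_finrank_derived_le`).

The lower bound on `n` comes from `f`, the dimension of the odd part of `L²`: `n ≥ f + 1` with one
odd generator and `n ≥ f + 2` with two. Write `x` for an even and `y`, `z` for odd generators.
Generators `y`, `z`: one of `[y, [y, z]]`, `[z, [z, y]]` is nonzero, so `f ≥ 1` and `n ≥ 3`, while
`dim M(L) ≤ 4`. Generators `x`, `y` with `[y, y] = 0`: `f ≥ 3` and `n ≥ 4`, while `dim M(L) ≤ 5`.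
Generators `x`, `y` with `[y, y] ≠ 0`: `dim M(L) ≤ 4`, which suffices if `f ≥ 2`. If `f = 1`, then
`n ≥ 2` and the sharper bound `dim M(L) ≤ 3` holds. -/

theorem koszulSign_zero_left (K : Type u) [Field K] (j : ZMod 2) : koszulSign K 0 j = 1 := by
  simp [koszulSign]

theorem koszulSign_one_one (K : Type u) [Field K] : koszulSign K 1 1 = -1 := by
  simp [koszulSign, ZMod.val_one]

/-! ### Brackets, the lower central series and generation -/

section General

variable {K : Type u} {L : Type v} [Field K] [AddCommGroup L] [Module K L] [LieSuperalgebra K L]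

theorem exists_homogeneous_add (x : L) : ∃ a ∈ grade (K := K) (L := L) 0,
    ∃ b ∈ grade (K := K) (L := L) 1, a + b = x := by
  apply Submodule.mem_sup.mp
  rw [isCompl_grade.sup_eq_top]
  trivial

theorem bracketSpan_le_iff {S T V : Submodule K L} :
    bracketSpan K L S T ≤ V ↔ ∀ s ∈ S, ∀ t ∈ T, bracket (K := K) s t ∈ V := by
  constructor
  · intro h s hs t ht
    exact h (Submodule.subset_span ⟨s, hs, t, ht, rfl⟩)
  · intro h
    rw [bracketSpan, Submodule.span_le]
    rintro _ ⟨s, hs, t, ht, rfl⟩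
    exact h s hs t ht

theorem bracket_mem_bracketSpan {S T : Submodule K L} {s t : L} (hs : s ∈ S) (ht : t ∈ T) :
    bracket (K := K) s t ∈ bracketSpan K L S T :=
  bracketSpan_le_iff.mp le_rfl s hs t ht

theorem bracket_mem_derived (s t : L) : bracket (K := K) s t ∈ derived K L :=
  bracket_mem_bracketSpan trivial trivial

theorem bracketSpan_span_le {A B : Set L} {V : Submodule K L}
    (h : ∀ a ∈ A, ∀ b ∈ B, bracket (K := K) a b ∈ V) :
    bracketSpan K L (Submodule.span K A) (Submodule.span K B) ≤ V := by
  rw [bracketSpan_le_iff]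
  intro s hs t ht
  induction hs using Submodule.span_induction with
  | mem s hs =>
    induction ht using Submodule.span_induction with
    | mem t ht => exact h s hs t ht
    | zero => simp
    | add y z _ _ hy hz => rw [map_add]; exact add_mem hy hz
    | smul c y _ hy => rw [map_smul]; exact Submodule.smul_mem _ _ hy
  | zero => simp
  | add y z _ _ hy hz => rw [map_add, LinearMap.add_apply]; exact add_mem hy hz
  | smul c y _ hy => rw [map_smul, LinearMap.smul_apply]; exact Submodule.smul_mem _ _ hy

theorem bracket_mem_lowerCentral_succ (s : L) {t : L} {k : ℕ} (ht : t ∈ lowerCentral K L k) :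
    bracket (K := K) s t ∈ lowerCentral K L (k + 1) :=
  bracket_mem_bracketSpan trivial ht

/-- The Jacobi identity on homogeneous components writes `[[s, t], c]` through `[s, [t, c]]` and
`[t, [s, c]]`, so an element of `L²` moves two steps down the series. -/
theorem bracket_bracket_mem_lowerCentral (s t : L) {c : L} {k : ℕ}
    (hc : c ∈ lowerCentral K L k) :
    bracket (K := K) (bracket (K := K) s t) c ∈ lowerCentral K L (k + 2) := by
  have key : ∀ {i j : ZMod 2} {a b : L}, a ∈ grade (K := K) i → b ∈ grade (K := K) j →
      bracket (K := K) (bracket (K := K) a b) c ∈ lowerCentral K L (k + 2) := by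
    intro i j a b ha hb
    rw [eq_sub_of_add_eq (bracket_jacobi ha hb c).symm]
    exact sub_mem (bracket_mem_lowerCentral_succ _ (bracket_mem_lowerCentral_succ _ hc))
      (Submodule.smul_mem _ _
        (bracket_mem_lowerCentral_succ _ (bracket_mem_lowerCentral_succ _ hc)))
  obtain ⟨s₀, hs₀, s₁, hs₁, rfl⟩ := exists_homogeneous_add (K := K) s
  obtain ⟨t₀, ht₀, t₁, ht₁, rfl⟩ := exists_homogeneous_add (K := K) t
  simp only [map_add, LinearMap.add_apply]
  exact add_mem (add_mem (key hs₀ ht₀) (key hs₁ ht₀)) (add_mem (key hs₀ ht₁) (key hs₁ ht₁))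

theorem bracket_mem_lowerCentral_add_two {s c : L} {k : ℕ} (hs : s ∈ derived K L)
    (hc : c ∈ lowerCentral K L k) : bracket (K := K) s c ∈ lowerCentral K L (k + 2) := by
  have h : derived K L ≤ (lowerCentral K L (k + 2)).comap (bracket (K := K).flip c) :=
    bracketSpan_le_iff.mpr fun a _ b _ => bracket_bracket_mem_lowerCentral a b hc
  exact h hs

theorem bracket_pow_mem_lowerCentral (x y : L) (k : ℕ) :
    ((bracket (K := K) x) ^ k) y ∈ lowerCentral K L k := by
  induction k with
  | zero => trivial
  | succ k ih =>
    rw [pow_succ', Module.End.mul_apply]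
    exact bracket_mem_lowerCentral_succ _ ih

theorem IsNilpotent.isNilpotent_bracket (h : IsNilpotent K L) (x : L) :
    _root_.IsNilpotent (bracket (K := K) x) := by
  obtain ⟨k, hk⟩ := h
  refine ⟨k, LinearMap.ext fun y => ?_⟩
  have := bracket_pow_mem_lowerCentral (K := K) x y k
  rwa [hk, Submodule.mem_bot] at this

/-- If `U` generates `L` modulo `L²` and `R`, and `S` contains `[U, U]`, `[U, S]`, `[R, L]` and
`[U, R]`, then `S` contains `L²` up to arbitrarily deep terms of the lower central series. -/
theorem derived_le_sup_lowerCentral {U S R : Submodule K L}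
    (hgen : ∀ z : L, z ∈ U ⊔ derived K L ⊔ R)
    (hUU : bracketSpan K L U U ≤ S) (hUS : bracketSpan K L U S ≤ S)
    (hRL : bracketSpan K L R ⊤ ≤ S) (hUR : bracketSpan K L U R ≤ S) (k : ℕ) :
    derived K L ≤ S ⊔ lowerCentral K L (k + 1) := by
  rw [bracketSpan_le_iff] at hUU hUS hRL hUR
  -- The first argument may be taken in `U`: its component in `L²` lowers `t` by two steps, and its
  -- component in `R` brackets into `S`.
  have split : ∀ {s t : L} {k : ℕ}, t ∈ lowerCentral K L k →
      (∀ u ∈ U, bracket (K := K) u t ∈ S ⊔ lowerCentral K L (k + 2)) →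
      bracket (K := K) s t ∈ S ⊔ lowerCentral K L (k + 2) := by
    intro s t k ht hU
    obtain ⟨s', hs', r, hr, rfl⟩ := Submodule.mem_sup.mp (hgen s)
    obtain ⟨a, ha, d, hd, rfl⟩ := Submodule.mem_sup.mp hs'
    simp only [map_add, LinearMap.add_apply]
    exact add_mem (add_mem (hU a ha)
      (Submodule.mem_sup_right (bracket_mem_lowerCentral_add_two hd ht)))
      (Submodule.mem_sup_left (hRL r hr t trivial))
  -- Each term of the series lies in `S` up to the next term; iterating pushes the error as deep as
  -- desired.
  have step : ∀ k, lowerCentral K L (k + 1) ≤ S ⊔ lowerCentral K L (k + 2) := by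
    intro k
    induction k with
    | zero =>
      refine bracketSpan_le_iff.mpr fun s _ t ht => split ht fun a ha => ?_
      obtain ⟨t', ht', r, hr, rfl⟩ := Submodule.mem_sup.mp (hgen t)
      obtain ⟨b, hb, d, hd, rfl⟩ := Submodule.mem_sup.mp ht'
      simp only [map_add]
      exact add_mem (add_mem (Submodule.mem_sup_left (hUU a ha b hb))
        (Submodule.mem_sup_right (bracket_mem_lowerCentral_succ (k := 1) a hd)))
        (Submodule.mem_sup_left (hUR a ha r hr))
    | succ k ih =>
      refine bracketSpan_le_iff.mpr fun s _ t ht => split ht fun a ha => ?_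
      obtain ⟨b, hb, d, hd, rfl⟩ := Submodule.mem_sup.mp (ih ht)
      rw [map_add]
      exact add_mem (Submodule.mem_sup_left (hUS a ha b hb))
        (Submodule.mem_sup_right (bracket_mem_lowerCentral_succ _ hd))
  induction k with
  | zero => exact le_sup_right
  | succ k ih => exact ih.trans (sup_le le_sup_left (step k))

/-- Closure test used throughout: in the nilpotent case the error term disappears, so a subspace
that contains the brackets of the generators and is stable under bracketing with them contains all
of `L²`. -/
theorem IsNilpotent.derived_le (hnil : IsNilpotent K L) {A : Set L} {S : Submodule K L}
    (hgen : ∀ z : L, z ∈ Submodule.span K A ⊔ derived K L)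
    (hAA : ∀ a ∈ A, ∀ b ∈ A, bracket (K := K) a b ∈ S)
    (hAS : ∀ a ∈ A, ∀ b ∈ S, bracket (K := K) a b ∈ S) : derived K L ≤ S := by
  obtain ⟨k, hk⟩ := hnil
  have h := derived_le_sup_lowerCentral (K := K) (L := L) (U := Submodule.span K A) (S := S)
    (R := ⊥) (by simpa using hgen) (bracketSpan_span_le hAA)
    (by
      rw [← Submodule.span_eq S]
      exact bracketSpan_span_le (by simpa using hAS))
    (bracketSpan_le_iff.mpr (by simp)) (bracketSpan_le_iff.mpr (by simp)) k
  have hk' : lowerCentral K L (k + 1) = ⊥ := by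
    rw [eq_bot_iff]
    refine bracketSpan_le_iff.mpr fun s _ t ht => ?_
    rw [hk, Submodule.mem_bot] at ht
    simp [ht]
  rwa [hk', sup_bot_eq] at h

theorem IsNilpotent.derived_le_span (hnil : IsNilpotent K L) {A B : Set L}
    (hgen : ∀ z : L, z ∈ Submodule.span K A ⊔ derived K L)
    (hAA : ∀ a ∈ A, ∀ b ∈ A, bracket (K := K) a b ∈ Submodule.span K B)
    (hAB : ∀ a ∈ A, ∀ b ∈ B, bracket (K := K) a b ∈ Submodule.span K B) :
    derived K L ≤ Submodule.span K B :=
  hnil.derived_le hgen hAA fun a ha b hb =>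
    bracketSpan_le_iff.mp (bracketSpan_span_le hAB) a (Submodule.subset_span ha) b hb

theorem IsNilpotent.finrank_derived_le (hnil : IsNilpotent K L) {A : Set L} {c : ℕ}
    (t : Fin c → L) (hgen : ∀ z : L, z ∈ Submodule.span K A ⊔ derived K L)
    (hAA : ∀ a ∈ A, ∀ b ∈ A, bracket (K := K) a b ∈ Submodule.span K (Set.range t))
    (hAt : ∀ a ∈ A, ∀ i, bracket (K := K) a (t i) ∈ Submodule.span K (Set.range t)) :
    Module.finrank K (derived K L) ≤ c := by
  have h : derived K L ≤ Submodule.span K (Set.range t) := by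
    refine hnil.derived_le_span hgen hAA ?_
    rintro a ha _ ⟨i, rfl⟩
    exact hAt a ha i
  have := FiniteDimensional.span_of_finite K (Set.finite_range t)
  refine (Submodule.finrank_mono h).trans ?_
  exact (finrank_range_le_card (R := K) t).trans_eq (Fintype.card_fin c)

/-! ### Sign rules for even and odd elements -/

theorem bracket_even_skew {x : L} (hx : x ∈ grade (K := K) (L := L) 0) (y : L) :
    bracket (K := K) x y = -bracket (K := K) y x := by
  obtain ⟨y₀, hy₀, y₁, hy₁, rfl⟩ := exists_homogeneous_add (K := K) y
  have h₀ := bracket_skew hx hy₀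
  have h₁ := bracket_skew hx hy₁
  rw [koszulSign_zero_left, one_smul] at h₀ h₁
  rw [map_add, map_add, LinearMap.add_apply, h₀, h₁, neg_add]

theorem bracket_odd_symm {x y : L} (hx : x ∈ grade (K := K) (L := L) 1)
    (hy : y ∈ grade (K := K) (L := L) 1) : bracket (K := K) x y = bracket (K := K) y x := by
  have h := bracket_skew hx hy
  rwa [koszulSign_one_one, neg_one_smul, neg_neg] at h

theorem bracket_even_jacobi {x : L} (hx : x ∈ grade (K := K) (L := L) 0) (y z : L) :
    bracket (K := K) x (bracket (K := K) y z) =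
      bracket (K := K) (bracket (K := K) x y) z + bracket (K := K) y (bracket (K := K) x z) := by
  obtain ⟨y₀, hy₀, y₁, hy₁, rfl⟩ := exists_homogeneous_add (K := K) y
  have h₀ := bracket_jacobi hx hy₀ z
  have h₁ := bracket_jacobi hx hy₁ z
  rw [koszulSign_zero_left, one_smul] at h₀ h₁
  simp only [map_add, LinearMap.add_apply, h₀, h₁]
  abel

theorem bracket_odd_jacobi {x y : L} (hx : x ∈ grade (K := K) (L := L) 1)
    (hy : y ∈ grade (K := K) (L := L) 1) (z : L) :
    bracket (K := K) x (bracket (K := K) y z) =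
      bracket (K := K) (bracket (K := K) x y) z - bracket (K := K) y (bracket (K := K) x z) := by
  have h := bracket_jacobi hx hy z
  rwa [koszulSign_one_one, neg_one_smul, ← sub_eq_add_neg] at h

theorem bracket_mem_odd_odd {x y : L} (hx : x ∈ grade (K := K) (L := L) 1)
    (hy : y ∈ grade (K := K) (L := L) 1) : bracket (K := K) x y ∈ grade (K := K) (L := L) 0 := by
  have h := bracket_mem hx hy
  rwa [show (1 + 1 : ZMod 2) = 0 by decide] at h

theorem bracket_mem_even_odd {x y : L} (hx : x ∈ grade (K := K) (L := L) 0)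
    (hy : y ∈ grade (K := K) (L := L) 1) : bracket (K := K) x y ∈ grade (K := K) (L := L) 1 := by
  have h := bracket_mem hx hy
  rwa [zero_add] at h

theorem bracket_mem_odd_even {x y : L} (hx : x ∈ grade (K := K) (L := L) 1)
    (hy : y ∈ grade (K := K) (L := L) 0) : bracket (K := K) x y ∈ grade (K := K) (L := L) 1 := by
  have h := bracket_mem hx hy
  rwa [add_zero] at h

theorem bracket_mem_even_even {x y : L} (hx : x ∈ grade (K := K) (L := L) 0)
    (hy : y ∈ grade (K := K) (L := L) 0) : bracket (K := K) x y ∈ grade (K := K) (L := L) 0 := by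
  have h := bracket_mem hx hy
  rwa [add_zero] at h

theorem bracket_even_self (h2 : (2 : K) ≠ 0) {x : L} (hx : x ∈ grade (K := K) (L := L) 0) :
    bracket (K := K) x x = 0 := by
  have h : (2 : K) • bracket (K := K) x x = 0 := by
    rw [two_smul, ← eq_neg_iff_add_eq_zero]
    exact bracket_even_skew hx x
  exact (smul_eq_zero.mp h).resolve_left h2

/-- The Jacobi identity for `y, y, y` gives `3 [y, [y, y]] = 0`. -/
theorem bracket_odd_self_self (h3 : (3 : K) ≠ 0) {y : L} (hy : y ∈ grade (K := K) (L := L) 1) :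
    bracket (K := K) y (bracket (K := K) y y) = 0 := by
  have h : (3 : K) • bracket (K := K) y (bracket (K := K) y y) = 0 := by
    have h₁ := bracket_odd_jacobi hy hy y
    rw [bracket_even_skew (bracket_mem_odd_odd hy hy) y] at h₁
    linear_combination (norm := module) h₁
  exact (smul_eq_zero.mp h).resolve_left h3

/-- For odd `y` this is `2 (ad y)² = ad [y, y]`: it makes `ad y` square to zero when `[y, y] = 0`.
-/
theorem two_smul_bracket_odd_odd {y : L} (hy : y ∈ grade (K := K) (L := L) 1) (z : L) :
    (2 : K) • bracket (K := K) y (bracket (K := K) y z) =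
      bracket (K := K) (bracket (K := K) y y) z := by
  have h := bracket_odd_jacobi hy hy z
  linear_combination (norm := module) h

theorem bracket_odd_odd_self {y v : L} (hy : y ∈ grade (K := K) (L := L) 1) :
    bracket (K := K) v (bracket (K := K) y y) =
      (-2 : K) • bracket (K := K) y (bracket (K := K) y v) := by
  rw [neg_smul, two_smul_bracket_odd_odd hy v, bracket_even_skew (bracket_mem_odd_odd hy hy) v,
    neg_neg]

theorem bracket_even_odd_self {x y : L} (hx : x ∈ grade (K := K) (L := L) 0)
    (hy : y ∈ grade (K := K) (L := L) 1) :
    bracket (K := K) x (bracket (K := K) y y) =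
      (2 : K) • bracket (K := K) y (bracket (K := K) x y) := by
  rw [bracket_even_jacobi hx, bracket_odd_symm (bracket_mem_even_odd hx hy) hy, two_smul]

end General

end LieSuperalgebra

/-! ### Linear algebra -/

theorem linearIndependent_pow_apply_of_isNilpotent {K : Type u} {V : Type v} [Field K]
    [AddCommGroup V] [Module K V] {T : Module.End K V} (hT : IsNilpotent T) {k : ℕ} {v : V}
    (hv : (T ^ k) v ≠ 0) : LinearIndependent K fun i : Fin (k + 1) => (T ^ (i : ℕ)) v := by
  induction k generalizing v with
  | zero =>
    have : v ≠ 0 := by simpa using hv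
    have : LinearIndependent K fun i : Fin 1 => (T ^ (i : ℕ)) v :=
      LinearIndependent.of_subsingleton 0 (by simpa using this)
    exact this
  | succ k ih =>
    have hk := ih (v := T v) (by rwa [pow_succ, Module.End.mul_apply] at hv)
    have hs : (fun i : Fin (k + 1 + 1) => (T ^ (i : ℕ)) v) =
        Fin.cons v fun i : Fin (k + 1) => (T ^ (i : ℕ)) (T v) := by
      funext i
      refine Fin.cases ?_ (fun j => ?_) i
      · simp
      · simp [pow_succ]
    rw [hs]
    -- If `v` were a combination of `T v, T² v, …`, the span `W` of its orbit would satisfy `W ≤ T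
    -- W`, hence `W ≤ T ^ n W = 0` for large `n`.
    refine hk.finCons fun hmem => ?_
    set W : Submodule K V := Submodule.span K (Set.range fun i : ℕ => (T ^ i) v) with hW
    have hWT : W ≤ W.map T := by
      have hv' : v ∈ W.map T := by
        refine Submodule.span_le.mpr ?_ hmem
        rintro _ ⟨i, rfl⟩
        refine ⟨(T ^ (i : ℕ)) v, Submodule.subset_span ⟨i, rfl⟩, ?_⟩
        simp only [← Module.End.mul_apply, ← pow_succ, ← pow_succ']
      rw [hW, Submodule.span_le]
      rintro _ ⟨i, rfl⟩
      cases i with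
      | zero => simpa using hv'
      | succ i =>
        refine ⟨(T ^ i) v, Submodule.subset_span ⟨i, rfl⟩, ?_⟩
        simp only [← Module.End.mul_apply, ← pow_succ']
    have hpow : ∀ n : ℕ, W ≤ W.map (T ^ n) := by
      intro n
      induction n with
      | zero => rw [pow_zero, Module.End.one_eq_id, Submodule.map_id]
      | succ n ihn =>
        rw [pow_succ', Module.End.mul_eq_comp, Submodule.map_comp]
        exact hWT.trans (Submodule.map_mono ihn)
    obtain ⟨n, hn⟩ := hT
    have hv0 : v ∈ W := Submodule.subset_span ⟨0, by simp⟩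
    have := hpow n hv0
    rw [hn] at this
    obtain ⟨_, _, rfl⟩ := this
    simp at hv

/-- A spanning family of a subspace, extended to a spanning family of a larger subspace. -/
theorem Submodule.exists_le_span_sup {K : Type u} {V : Type v} [Field K]
    [AddCommGroup V] [Module K V] {D E : Submodule K V} [FiniteDimensional K E] (hDE : D ≤ E)
    {j : ℕ} (hj : Module.finrank K E ≤ Module.finrank K D + j) :
    ∃ t : Fin j → V, E ≤ D ⊔ span K (Set.range t) := by
  induction j generalizing D with
  | zero =>
    refine ⟨Fin.elim0, ?_⟩
    rw [Submodule.eq_of_le_of_finrank_le hDE (by simpa using hj)]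
    exact le_sup_left
  | succ j ih =>
    by_cases h : E ≤ D
    · exact ⟨fun _ => 0, h.trans le_sup_left⟩
    · obtain ⟨x, hxE, hxD⟩ := Set.not_subset.mp h
      have hD' : D ⊔ span K {x} ≤ E := sup_le hDE ((span_singleton_le_iff_mem _ _).mpr hxE)
      have : FiniteDimensional K ↥(D ⊔ span K {x}) := finiteDimensional_of_le hD'
      have hlt : Module.finrank K D < Module.finrank K ↥(D ⊔ span K {x}) := by
        refine finrank_lt_finrank_of_lt (lt_of_le_of_ne le_sup_left fun heq => hxD ?_)
        rw [heq]
        exact mem_sup_right (mem_span_singleton_self x)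
      obtain ⟨t, ht⟩ := ih hD' (by omega)
      refine ⟨Fin.cons x t, ?_⟩
      rw [Fin.range_cons, span_insert, ← sup_assoc]
      exact ht

/-- If `D` is spanned by `c` elements modulo `N ≤ R ⊓ D`, where `R` is the kernel of `φ`, then
`(R ⊓ D) / N` and `φ(D)` have total dimension at most `c`. -/
theorem rank_quotient_add_finrank_map_le {K : Type u} {V : Type w} {W : Type v} [Field K]
    [AddCommGroup V] [Module K V] [AddCommGroup W] [Module K W] (φ : V →ₗ[K] W)
    {D N : Submodule K V} (hN : N ≤ LinearMap.ker φ) {c : ℕ} (t : Fin c → V)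
    (hD : D ≤ Submodule.span K (Set.range t) ⊔ N) {r : ℕ}
    (hr : Module.rank K (↥(LinearMap.ker φ ⊓ D) ⧸ N.submoduleOf (LinearMap.ker φ ⊓ D)) = r) :
    r + Module.finrank K (D.map φ) ≤ c := by
  set M := LinearMap.ker φ ⊓ D with hM
  -- `E = D / N` has dimension at most `c`. The induced map `E → W` has image `φ(D)`, and its kernel
  -- contains a copy of `(R ⊓ D) / N`; rank-nullity finishes.
  set E : Submodule K (V ⧸ N) := D.map N.mkQ with hE
  have hEle : E ≤ Submodule.span K (Set.range (N.mkQ ∘ t)) := by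
    refine (Submodule.map_mono hD).trans ?_
    rw [Submodule.map_sup, Submodule.map_span, ← Set.range_comp, Submodule.mkQ_map_self, sup_bot_eq]
  have hfin := FiniteDimensional.span_of_finite K (Set.finite_range (N.mkQ ∘ t))
  have hfinE : FiniteDimensional K E := Submodule.finiteDimensional_of_le hEle
  have hEc : Module.finrank K E ≤ c :=
    (Submodule.finrank_mono hEle).trans 
      ((finrank_range_le_card (R := K) (N.mkQ ∘ t)).trans_eq (Fintype.card_fin c))
  let ψ : (V ⧸ N) →ₗ[K] W := N.liftQ φ hN
  have hψ : ψ ∘ₗ N.mkQ = φ := N.liftQ_mkQ φ hN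
  let χ : E →ₗ[K] W := ψ.domRestrict E
  have hrange : LinearMap.range χ = D.map φ := by
    rw [LinearMap.range_domRestrict, hE, ← Submodule.map_comp, hψ]
  have hrn := LinearMap.finrank_range_add_finrank_ker χ
  rw [hrange] at hrn
  set g : M →ₗ[K] V ⧸ N := N.mkQ ∘ₗ M.subtype with hgdef
  have hg : LinearMap.ker g = N.submoduleOf M := by
    rw [hgdef, LinearMap.ker_comp, Submodule.ker_mkQ, Submodule.submoduleOf]
  have hgr : LinearMap.range g ≤ (LinearMap.ker χ).map E.subtype := by
    rintro _ ⟨x, rfl⟩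
    exact ⟨⟨N.mkQ x, x, x.2.2, rfl⟩, x.2.1, rfl⟩
  have hle : r ≤ Module.finrank K (LinearMap.ker χ) := by
    rw [← hg] at hr
    rw [← Module.finrank_eq_of_rank_eq hr, LinearEquiv.finrank_eq (LinearMap.quotKerEquivRange g),
      ← Submodule.finrank_map_subtype_eq]
    exact Submodule.finrank_mono hgr
  omega

/-! ### Structure of two-generated nilpotent superalgebras -/

namespace LieSuperalgebra

section TwoGenerators

variable {K : Type u} {L : Type v} [Field K] [AddCommGroup L] [Module K L] [LieSuperalgebra K L]

/-- An even `x` preserves the odd part of `L²` and acts nilpotently, so `v, [x, v], …, (ad x)^k v`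
are independent there. Read contrapositively, a small odd part forces brackets to vanish. -/
theorem IsNilpotent.succ_le_finrank_odd_derived [FiniteDimensional K L] (hnil : IsNilpotent K L)
    {x v : L} (hx : x ∈ grade (K := K) (L := L) 0)
    (hv : v ∈ grade (K := K) (L := L) 1 ⊓ derived K L) {k : ℕ}
    (hk : ((bracket (K := K) x) ^ k) v ≠ 0) :
    k + 1 ≤ Module.finrank K ↥(grade (K := K) (L := L) 1 ⊓ derived K L) := by
  have hmem : ∀ i : ℕ, ((bracket (K := K) x) ^ i) v ∈
      grade (K := K) (L := L) 1 ⊓ derived K L := by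
    intro i
    induction i with
    | zero => simpa using hv
    | succ i ih =>
      rw [pow_succ', Module.End.mul_apply]
      exact ⟨bracket_mem_even_odd hx ih.1, bracket_mem_derived _ _⟩
  have hli := linearIndependent_pow_apply_of_isNilpotent (hnil.isNilpotent_bracket x) hk
  have h := finrank_span_eq_card hli
  rw [Fintype.card_fin] at h
  rw [← h]
  refine Submodule.finrank_mono (Submodule.span_le.mpr ?_)
  rintro _ ⟨i, rfl⟩
  exact hmem i

/-- A Lie superalgebra is generated modulo its derived algebra by homogeneous elements. -/
theorem exists_homogeneous_generators [FiniteDimensional K L]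
    (h : Module.finrank K L = Module.finrank K (derived K L) + 2) :
    ∃ (i j : ZMod 2) (x y : L), x ∈ grade (K := K) i ∧ y ∈ grade (K := K) j ∧
      ∀ z : L, z ∈ Submodule.span K {x, y} ⊔ derived K L := by
  classical
  set D := derived K L with hD
  set s : Set (L ⧸ D) := D.mkQ '' {x | ∃ i, x ∈ grade (K := K) (L := L) i} with hs
  have hspan : Submodule.span K s = ⊤ := by
    rw [eq_top_iff]
    rintro z -
    obtain ⟨z, rfl⟩ := D.mkQ_surjective z
    obtain ⟨a, ha, b, hb, rfl⟩ := exists_homogeneous_add (K := K) z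
    rw [map_add]
    exact add_mem (Submodule.subset_span ⟨a, ⟨0, ha⟩, rfl⟩)
      (Submodule.subset_span ⟨b, ⟨1, hb⟩, rfl⟩)
  -- The images of homogeneous elements span `L / L²`, so a basis, which has two elements, can be
  -- chosen among them.
  obtain ⟨b, hbs, hb, hli⟩ := exists_linearIndependent K s
  rw [hspan] at hb
  have hfin : b.Finite := hli.setFinite
  have := hfin.fintype
  have hcard : b.toFinset.card = 2 := by
    rw [← finrank_span_set_eq_card hli, hb, finrank_top]
    have := D.finrank_quotient_add_finrank
    omega
  obtain ⟨p, q, -, hpq⟩ := Finset.card_eq_two.mp hcard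
  have hb' : b = {p, q} := by
    rw [← Set.coe_toFinset b, hpq]
    simp
  subst hb'
  obtain ⟨x, ⟨i, hx⟩, rfl⟩ := hbs (Set.mem_insert _ _)
  obtain ⟨y, ⟨j, hy⟩, rfl⟩ := hbs (Set.mem_insert_of_mem _ rfl)
  refine ⟨i, j, x, y, hx, hy, fun z => ?_⟩
  have hz : D.mkQ z ∈ (Submodule.span K {x, y}).map D.mkQ := by
    rw [Submodule.map_span, Set.image_pair, hb]
    trivial
  rw [← Submodule.mem_comap, Submodule.comap_map_mkQ, sup_comm] at hz
  exact hz

/-- The even part contains both generators and is closed under the bracket, so it is all of `L`. -/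
theorem IsNilpotent.grade_one_eq_bot (hnil : IsNilpotent K L) {x y : L}
    (hx : x ∈ grade (K := K) (L := L) 0) (hy : y ∈ grade (K := K) (L := L) 0)
    (hgen : ∀ z : L, z ∈ Submodule.span K {x, y} ⊔ derived K L) :
    grade (K := K) (L := L) 1 = ⊥ := by
  have hxy : ∀ a ∈ ({x, y} : Set L), a ∈ grade (K := K) (L := L) 0 := by
    rintro a (rfl | rfl) <;> assumption
  have hD : derived K L ≤ grade (K := K) (L := L) 0 :=
    hnil.derived_le hgen
      (fun a ha b hb => bracket_mem_even_even (hxy a ha) (hxy b hb))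
      (fun a ha b hb => bracket_mem_even_even (hxy a ha) hb)
  have htop : grade (K := K) (L := L) 0 = ⊤ := by
    rw [eq_top_iff]
    intro z _
    exact (sup_le (Submodule.span_le.mpr hxy) hD) (hgen z)
  have := (isCompl_grade (K := K) (L := L)).inf_eq_bot
  rwa [htop, top_inf_eq] at this

/-- Compare dimensions in `L = K x + (L₁ + L²)`. -/
theorem finrank_odd_derived_add_one_le [FiniteDimensional K L] {x y : L}
    (hy : y ∈ grade (K := K) (L := L) 1)
    (hgen : ∀ z : L, z ∈ Submodule.span K {x, y} ⊔ derived K L)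
    (h : Module.finrank K L = Module.finrank K (derived K L) + 2) :
    Module.finrank K ↥(grade (K := K) (L := L) 1 ⊓ derived K L) + 1 ≤
      Module.finrank K (grade (K := K) (L := L) 1) := by
  have h₁ := Submodule.finrank_sup_add_finrank_inf_eq (grade (K := K) (L := L) 1) (derived K L)
  have h₂ : (⊤ : Submodule K L) ≤
      Submodule.span K {x} ⊔ (grade (K := K) (L := L) 1 ⊔ derived K L) := by
    intro z _
    refine (?_ : Submodule.span K {x, y} ⊔ derived K L ≤ _) (hgen z)
    rw [Submodule.span_insert]
    refine sup_le (sup_le le_sup_left ?_) (le_sup_right.trans le_sup_right)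
    exact ((Submodule.span_singleton_le_iff_mem _ _).mpr hy).trans
      (le_sup_left.trans le_sup_right)
  have h₃ := Submodule.finrank_mono h₂
  have h₄ := Submodule.finrank_add_le_finrank_add_finrank (Submodule.span K {x})
    (grade (K := K) (L := L) 1 ⊔ derived K L)
  have h₅ : Module.finrank K (Submodule.span K {x}) ≤ 1 := by
    exact (finrank_span_le_card ({x} : Set L)).trans (by simp)
  rw [finrank_top] at h₃
  omega

theorem finrank_odd_derived_add_two_le [FiniteDimensional K L] {x y : L}
    (hx : x ∈ grade (K := K) (L := L) 1) (hy : y ∈ grade (K := K) (L := L) 1)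
    (hgen : ∀ z : L, z ∈ Submodule.span K {x, y} ⊔ derived K L)
    (h : Module.finrank K L = Module.finrank K (derived K L) + 2) :
    Module.finrank K ↥(grade (K := K) (L := L) 1 ⊓ derived K L) + 2 ≤
      Module.finrank K (grade (K := K) (L := L) 1) := by
  have h₁ := Submodule.finrank_sup_add_finrank_inf_eq (grade (K := K) (L := L) 1) (derived K L)
  have h₂ : grade (K := K) (L := L) 1 ⊔ derived K L = ⊤ := by
    rw [eq_top_iff]
    intro z _
    refine (sup_le_sup_right (Submodule.span_le.mpr ?_) _ :
      Submodule.span K {x, y} ⊔ derived K L ≤ _) (hgen z)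
    rintro a (rfl | rfl) <;> assumption
  rw [h₂, finrank_top] at h₁
  omega

/-- For odd generators `y`, `z`, one of `[y, [y, z]]` and `[z, [y, z]]` does not vanish, unless
`dim L² ≤ 3`. -/
theorem IsNilpotent.bracket_odd_odd_ne_zero (hnil : IsNilpotent K L) (h3 : (3 : K) ≠ 0) {y z : L}
    (hy : y ∈ grade (K := K) (L := L) 1) (hz : z ∈ grade (K := K) (L := L) 1)
    (hgen : ∀ a : L, a ∈ Submodule.span K {y, z} ⊔ derived K L)
    (hder : 3 < Module.finrank K (derived K L)) :
    bracket (K := K) y (bracket (K := K) y z) ≠ 0 ∨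
      bracket (K := K) z (bracket (K := K) z y) ≠ 0 := by
  by_contra! hpq
  obtain ⟨hp, hq⟩ := hpq
  -- If both vanish, then so do `[z, [y, y]] = -2 [y, [y, z]]` and `[y, [z, z]] = -2 [z, [z, y]]`,
  -- so the three brackets of the generators already span `L²`.
  refine absurd (hnil.finrank_derived_le
    ![bracket (K := K) y y, bracket (K := K) y z, bracket (K := K) z z] hgen ?_ ?_) (by omega)
  · rintro a (rfl | rfl) b (rfl | rfl)
    · exact Submodule.subset_span ⟨0, rfl⟩
    · exact Submodule.subset_span ⟨1, rfl⟩
    · rw [bracket_odd_symm hz hy]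
      exact Submodule.subset_span ⟨1, rfl⟩
    · exact Submodule.subset_span ⟨2, rfl⟩
  · rintro a (rfl | rfl) i <;> fin_cases i
    · simp [bracket_odd_self_self h3 hy]
    · simp [hp]
    · simp [bracket_odd_odd_self hz, hq]
    · simp [bracket_odd_odd_self hy, hp]
    · simp [bracket_odd_symm hy hz, hq]
    · simp [bracket_odd_self_self h3 hz]

theorem IsNilpotent.bracket_even_odd_ne_zero (hnil : IsNilpotent K L) (h2 : (2 : K) ≠ 0)
    (h3 : (3 : K) ≠ 0) {x y : L}
    (hx : x ∈ grade (K := K) (L := L) 0) (hy : y ∈ grade (K := K) (L := L) 1)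
    (hgen : ∀ z : L, z ∈ Submodule.span K {x, y} ⊔ derived K L)
    (hder : 1 < Module.finrank K (derived K L)) : bracket (K := K) x y ≠ 0 := by
  intro hw
  have hw' : bracket (K := K) y x = 0 := by
    rw [← neg_eq_zero, ← bracket_even_skew hx, hw]
  refine absurd (hnil.finrank_derived_le ![bracket (K := K) y y] hgen ?_ ?_) (by omega)
  · rintro a (rfl | rfl) b (rfl | rfl)
    · simp [bracket_even_self h2 hx]
    · simp [hw]
    · simp [hw']
    · exact Submodule.subset_span ⟨0, rfl⟩
  · rintro a (rfl | rfl) i <;> fin_cases i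
    · simp [bracket_even_odd_self hx hy, hw]
    · simp [bracket_odd_self_self h3 hy]

/-- If the odd part of `L²` had dimension at most two, then `w = [x, y]`, `v = [x, w]` and `c = [y,
v]` would span `L²`: every further bracket with a generator vanishes, against `dim L² > 3`. -/
theorem IsNilpotent.three_le_finrank_odd_derived [FiniteDimensional K L] (hnil : IsNilpotent K L)
    (h2 : (2 : K) ≠ 0) (h3 : (3 : K) ≠ 0) {x y : L}
    (hx : x ∈ grade (K := K) (L := L) 0) (hy : y ∈ grade (K := K) (L := L) 1)
    (hgen : ∀ z : L, z ∈ Submodule.span K {x, y} ⊔ derived K L)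
    (hder : 3 < Module.finrank K (derived K L)) (hyy : bracket (K := K) y y = 0) :
    3 ≤ Module.finrank K ↥(grade (K := K) (L := L) 1 ⊓ derived K L) := by
  set w := bracket (K := K) x y with hw
  set v := bracket (K := K) x w with hv
  set c := bracket (K := K) y v with hc
  have hwo : w ∈ grade (K := K) (L := L) 1 := bracket_mem_even_odd hx hy
  have hvo : v ∈ grade (K := K) (L := L) 1 := bracket_mem_even_odd hx hwo
  have hyx : bracket (K := K) y x = -w := by
    rw [hw, bracket_even_skew hx, neg_neg]
  by_contra! hlt
  have hxv : bracket (K := K) x v = 0 := by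
    by_contra hne
    refine absurd (hnil.succ_le_finrank_odd_derived hx ⟨hwo, bracket_mem_derived _ _⟩ (k := 2) ?_)
      (by omega)
    rwa [pow_two, Module.End.mul_apply]
  have hyw : bracket (K := K) y w = 0 := by
    have h := bracket_even_odd_self hx hy
    rw [hyy, map_zero] at h
    exact (smul_eq_zero.mp h.symm).resolve_left h2
  have hyc : bracket (K := K) y c = 0 := by
    have h := two_smul_bracket_odd_odd hy v
    rw [hyy, map_zero, LinearMap.zero_apply] at h
    exact (smul_eq_zero.mp h).resolve_left h2
  have hxc : bracket (K := K) x c = bracket (K := K) w v := by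
    rw [hc, bracket_even_jacobi hx, hxv, map_zero, add_zero]
  -- This is `[x, [y, w]] = 0` expanded by Jacobi. Applying `ad x` gives `2 [w, v] + [x, c] = 0`,
  -- and `[w, v] = [x, c]`, so `3 [x, c] = 0`.
  have hww : bracket (K := K) w w + c = 0 := by
    have h := bracket_even_jacobi hx y w
    rw [hyw, map_zero] at h
    exact h.symm
  have hxc' : bracket (K := K) x c = 0 := by
    have h : (3 : K) • bracket (K := K) x c = 0 := by
      have h₁ := congrArg (bracket (K := K) x) hww
      rw [map_add, map_zero, bracket_even_odd_self hx hwo, ← hv, ← hxc] at h₁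
      linear_combination (norm := module) h₁
    exact (smul_eq_zero.mp h).resolve_left h3
  refine absurd (hnil.finrank_derived_le ![w, v, c] hgen ?_ ?_) (by omega)
  · rintro a (rfl | rfl) b (rfl | rfl)
    · simp [bracket_even_self h2 hx]
    · exact Submodule.subset_span ⟨0, rfl⟩
    · rw [hyx]
      exact neg_mem (Submodule.subset_span ⟨0, rfl⟩)
    · simp [hyy]
  · rintro a (rfl | rfl) i <;> fin_cases i
    · exact Submodule.subset_span ⟨1, rfl⟩
    · simp [hxv]
    · simp [hxc']
    · simp [hyw]
    · exact Submodule.subset_span ⟨2, rfl⟩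
    · simp [hyc]

theorem IsNilpotent.derived_le_of_finrank_odd_derived_le_one [FiniteDimensional K L]
    (hnil : IsNilpotent K L) (h2 : (2 : K) ≠ 0) (h3 : (3 : K) ≠ 0) {x y w : L}
    (hx : x ∈ grade (K := K) (L := L) 0) (hy : y ∈ grade (K := K) (L := L) 1)
    (hgen : ∀ z : L, z ∈ Submodule.span K {x, y} ⊔ derived K L)
    (hodd : Module.finrank K ↥(grade (K := K) (L := L) 1 ⊓ derived K L) ≤ 1)
    (hw : bracket (K := K) x y = w) :
    bracket (K := K) x w = 0 ∧ derived K L ≤ Submodule.span K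
      {w, bracket (K := K) y y, bracket (K := K) y w, bracket (K := K) w w} := by
  have hwo : w ∈ grade (K := K) (L := L) 1 := hw ▸ bracket_mem_even_odd hx hy
  have hwD : w ∈ derived K L := hw ▸ bracket_mem_derived _ _
  have hyx : bracket (K := K) y x = -w := by
    rw [← hw, bracket_even_skew hx, neg_neg]
  -- A nonzero `[u, w]` would be independent of `w` in the odd part of `L²`, which has dimension at
  -- most one.
  have hzero : ∀ u ∈ grade (K := K) (L := L) 0, bracket (K := K) u w = 0 := by
    intro u hu
    by_contra hne
    refine absurd (hnil.succ_le_finrank_odd_derived hu ⟨hwo, hwD⟩ (k := 1) ?_) (by omega)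
    rwa [pow_one]
  have hxw := hzero x hx
  refine ⟨hxw, ?_⟩
  set b := bracket (K := K) y w with hb
  have hyb : bracket (K := K) y b = 0 := by
    have h := two_smul_bracket_odd_odd hy w
    rw [hzero _ (bracket_mem_odd_odd hy hy)] at h
    exact (smul_eq_zero.mp h).resolve_left h2
  have hxb : bracket (K := K) x b = bracket (K := K) w w := by
    rw [hb, bracket_even_jacobi hx, hw, hxw, map_zero, add_zero]
  have hxc : bracket (K := K) x (bracket (K := K) w w) = 0 := by
    rw [bracket_even_odd_self hx hwo, hxw, map_zero, smul_zero]
  have hyc : bracket (K := K) y (bracket (K := K) w w) = 0 := by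
    have h₁ : bracket (K := K) y (bracket (K := K) w w) = (-2 : K) • bracket (K := K) w b := by
      rw [bracket_odd_odd_self hwo, bracket_odd_symm hwo hy]
    have h₂ := bracket_even_jacobi hx y b
    rw [hyb, map_zero, hw, hxb, h₁] at h₂
    -- Here `h₂` reads `0 = [w, b] - 2 [w, b]`.
    have h₃ : bracket (K := K) w b = 0 := by
      linear_combination (norm := module) h₂
    rw [h₁, h₃, smul_zero]
  refine hnil.derived_le_span hgen ?_ ?_
  · rintro a (rfl | rfl) c (rfl | rfl)
    · simp [bracket_even_self h2 hx]
    · exact Submodule.subset_span (by simp [hw])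
    · rw [hyx]
      exact neg_mem (Submodule.subset_span (by simp))
    · exact Submodule.subset_span (by simp)
  · rintro a (rfl | rfl) c (rfl | rfl | rfl | rfl)
    · simp [hxw]
    · rw [bracket_even_odd_self hx hy, hw]
      exact Submodule.smul_mem _ _ (Submodule.subset_span (by simp [hb]))
    · rw [hxb]
      exact Submodule.subset_span (by simp)
    · simp [hxc]
    · exact Submodule.subset_span (by simp [hb])
    · simp [bracket_odd_self_self h3 hy]
    · simp [hyb]
    · simp [hyc]

end TwoGenerators

end LieSuperalgebra

/-! ### Surjective homomorphisms and the spanning bound for the multiplier -/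

theorem FreeLieSuper.lift_mem_grade {K : Type u} [Field K] {X : Type w} {p : X → ZMod 2}
    {L : Type v} [AddCommGroup L] [Module K L] [LieSuperalgebra K L] {φ : X → L}
    (hφ : ∀ x, φ x ∈ LieSuperalgebra.grade (K := K) (p x)) {i : ZMod 2} {a : FreeLieSuper K p}
    (ha : a ∈ LieSuperalgebra.grade (K := K) i) :
    lift φ hφ a ∈ LieSuperalgebra.grade (K := K) (L := L) i := by
  obtain ⟨r, hr, rfl⟩ := ha
  change evalHom K φ r ∈ _
  induction hr using Submodule.span_induction with
  | mem r h =>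
    obtain ⟨m, rfl, rfl⟩ := h
    rw [evalHom_mon]
    exact evalMon_mem hφ m
  | zero => simp
  | add y z _ _ hy hz => rw [map_add]; exact add_mem hy hz
  | smul t y _ hy => rw [map_smul]; exact Submodule.smul_mem _ _ hy

namespace LieSuperalgebra

/-- A surjective homomorphism of Lie superalgebras. -/
structure IsSurjectiveHom {K : Type u} {F : Type w} {L : Type v} [Field K]
    [AddCommGroup F] [Module K F] [LieSuperalgebra K F]
    [AddCommGroup L] [Module K L] [LieSuperalgebra K L] (φ : F →ₗ[K] L) : Prop where
  map_bracket : ∀ a b, φ (bracket (K := K) a b) = bracket (K := K) (φ a) (φ b)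
  map_grade : ∀ {i : ZMod 2} {a : F}, a ∈ grade (K := K) i → φ a ∈ grade (K := K) (L := L) i
  surjective : Function.Surjective φ

namespace IsSurjectiveHom

variable {K : Type u} {F : Type w} {L : Type v} [Field K]
  [AddCommGroup F] [Module K F] [LieSuperalgebra K F]
  [AddCommGroup L] [Module K L] [LieSuperalgebra K L] {φ : F →ₗ[K] L}

theorem map_lowerCentral (h : IsSurjectiveHom φ) (k : ℕ) {a : F} (ha : a ∈ lowerCentral K F k) :
    φ a ∈ lowerCentral K L k := by
  induction k generalizing a with
  | zero => trivial
  | succ k ih =>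
    refine (bracketSpan_le_iff (V := (lowerCentral K L (k + 1)).comap φ)).mpr
      (fun s _ t ht => ?_) ha
    rw [Submodule.mem_comap, h.map_bracket]
    exact bracket_mem_lowerCentral_succ _ (ih ht)

theorem map_derived (h : IsSurjectiveHom φ) : (derived K F).map φ = derived K L := by
  apply le_antisymm
  · rintro _ ⟨a, ha, rfl⟩
    exact h.map_lowerCentral 1 ha
  · refine bracketSpan_le_iff.mpr fun s _ t _ => ?_
    obtain ⟨s, rfl⟩ := h.surjective s
    obtain ⟨t, rfl⟩ := h.surjective t
    exact ⟨_, bracket_mem_derived s t, h.map_bracket s t⟩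

/-- Take the component of the right parity of any preimage. The image of the other component lies in
both the even and the odd part of `L`, so it is zero. -/
theorem exists_homogeneous_lift (h : IsSurjectiveHom φ) {i : ZMod 2} {x : L}
    (hx : x ∈ grade (K := K) i) : ∃ a ∈ grade (K := K) (L := F) i, φ a = x := by
  obtain ⟨f, hf⟩ := h.surjective x
  obtain ⟨a, ha, b, hb, rfl⟩ := exists_homogeneous_add (K := K) f
  rw [map_add] at hf
  have hdis := (isCompl_grade (K := K) (L := L)).disjoint
  rw [Submodule.disjoint_def] at hdis
  have h01 : ∀ i : ZMod 2, i = 0 ∨ i = 1 := by decide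
  rcases h01 i with rfl | rfl
  · have hb0 : φ b = 0 := by
      refine hdis _ ?_ (h.map_grade hb)
      rw [eq_sub_of_add_eq' hf]
      exact sub_mem hx (h.map_grade ha)
    exact ⟨a, ha, by rw [← hf, hb0, add_zero]⟩
  · have ha0 : φ a = 0 := by
      refine hdis _ (h.map_grade ha) ?_
      rw [eq_sub_of_add_eq hf]
      exact sub_mem hx (h.map_grade hb)
    exact ⟨b, hb, by rw [← hf, ha0, zero_add]⟩

/-- The kernel is graded because `φ` preserves parity, so graded skew-symmetry applies to
homogeneous components and turns `[F, R]` into `[R, F]`. -/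
theorem bracket_ker_right (h : IsSurjectiveHom φ) (s : F) {r : F} (hr : φ r = 0) :
    bracket (K := K) s r ∈ bracketSpan K F (LinearMap.ker φ) ⊤ := by
  have key : ∀ {i j : ZMod 2} {a b : F}, a ∈ grade (K := K) i → b ∈ grade (K := K) j → φ b = 0 →
      bracket (K := K) a b ∈ bracketSpan K F (LinearMap.ker φ) ⊤ := by
    intro i j a b ha hb hb0
    rw [bracket_skew ha hb]
    exact neg_mem (Submodule.smul_mem _ _ (bracket_mem_bracketSpan hb0 trivial))
  obtain ⟨a, ha, b, hb, rfl⟩ := exists_homogeneous_add (K := K) r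
  obtain ⟨s₀, hs₀, s₁, hs₁, rfl⟩ := exists_homogeneous_add (K := K) s
  have hdis := (isCompl_grade (K := K) (L := L)).disjoint
  rw [Submodule.disjoint_def] at hdis
  rw [map_add] at hr
  have ha0 : φ a = 0 := by
    refine hdis _ (h.map_grade ha) ?_
    rw [eq_neg_of_add_eq_zero_left hr]
    exact neg_mem (h.map_grade hb)
  have hb0 : φ b = 0 := by rwa [ha0, zero_add] at hr
  simp only [map_add, LinearMap.add_apply]
  exact add_mem (add_mem (key hs₀ ha ha0) (key hs₁ ha ha0))
    (add_mem (key hs₀ hb hb0) (key hs₁ hb hb0))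

/-- Let `A` generate `L` and let `B` span `L²`. If `c` elements span all brackets `[a, a']` and
`[a, b]` modulo `[R, F]`, then `dim M(L) + dim L² ≤ c`. -/
theorem rank_multiplier_add_finrank_derived_le (h : IsSurjectiveHom φ) (hnil : IsNilpotent K L)
    {A B : Set F} (hA : ∀ z : L, z ∈ Submodule.span K (φ '' A) ⊔ derived K L)
    (hB : derived K L ≤ Submodule.span K (φ '' B)) {c : ℕ} (t : Fin c → F)
    (hAA : ∀ a ∈ A, ∀ b ∈ A, bracket (K := K) a b ∈
      Submodule.span K (Set.range t) ⊔ bracketSpan K F (LinearMap.ker φ) ⊤)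
    (hAB : ∀ a ∈ A, ∀ b ∈ B, bracket (K := K) a b ∈
      Submodule.span K (Set.range t) ⊔ bracketSpan K F (LinearMap.ker φ) ⊤)
    {r : ℕ} (hr : Module.rank K (↥(LinearMap.ker φ ⊓ derived K F) ⧸
      (bracketSpan K F (LinearMap.ker φ) ⊤).submoduleOf (LinearMap.ker φ ⊓ derived K F)) = r) :
    r + Module.finrank K (derived K L) ≤ c := by
  set N := bracketSpan K F (LinearMap.ker φ) ⊤ with hN
  set U := Submodule.span K A with hU
  set Z := Submodule.span K B with hZ
  have hNR : N ≤ LinearMap.ker φ := by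
    refine bracketSpan_le_iff.mpr fun s hs t _ => ?_
    rw [LinearMap.mem_ker] at hs ⊢
    rw [h.map_bracket, hs, map_zero, LinearMap.zero_apply]
  have hgen : ∀ z : F, z ∈ U ⊔ derived K F ⊔ LinearMap.ker φ := by
    intro z
    have hz := hA (φ z)
    rwa [← Submodule.map_span, ← h.map_derived, ← Submodule.map_sup, ← Submodule.mem_comap,
      Submodule.comap_map_eq] at hz
  have hDZ : derived K F ≤ Z ⊔ LinearMap.ker φ := by
    rwa [← h.map_derived, ← Submodule.map_span, Submodule.map_le_iff_le_comap,
      Submodule.comap_map_eq] at hB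
  have hRN : ∀ s : F, ∀ r ∈ LinearMap.ker φ, bracket (K := K) s r ∈ N :=
    fun s r hr => h.bracket_ker_right s hr
  -- `S` is stable under bracketing with `U`: since `S ≤ F² ≤ Z + R`, the result lies in `[U, Z] +
  -- [R, F]`.
  set S := bracketSpan K F U U ⊔ bracketSpan K F U Z ⊔ N with hS
  have hSD : S ≤ derived K F := by
    refine sup_le (sup_le ?_ ?_) ?_ <;>
      exact bracketSpan_le_iff.mpr fun s _ t _ => bracket_mem_derived s t
  obtain ⟨k, hk⟩ := hnil
  have hDS := derived_le_sup_lowerCentral (K := K) (L := F) (U := U) (S := S)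
    (R := LinearMap.ker φ) hgen (le_sup_left.trans le_sup_left)
    (by
      refine bracketSpan_le_iff.mpr fun s hs t ht => ?_
      obtain ⟨z, hz, r, hr, rfl⟩ := Submodule.mem_sup.mp (hDZ (hSD ht))
      rw [map_add]
      exact add_mem
        (Submodule.mem_sup_left (Submodule.mem_sup_right (bracket_mem_bracketSpan hs hz)))
        (Submodule.mem_sup_right (hRN s r hr)))
    le_sup_right
    (bracketSpan_le_iff.mpr fun s _ r hr => Submodule.mem_sup_right (hRN s r hr)) k
  -- `C^k(L) = 0` means `C^k(F) ⊆ R`, so the next term lies in `[F, R]`.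
  have hC : lowerCentral K F (k + 1) ≤ N := by
    refine bracketSpan_le_iff.mpr fun s _ t ht => hRN s t ?_
    have := h.map_lowerCentral k ht
    rwa [hk, Submodule.mem_bot] at this
  have hST : S ≤ Submodule.span K (Set.range t) ⊔ N :=
    sup_le (sup_le (bracketSpan_span_le hAA) (bracketSpan_span_le hAB)) le_sup_right
  have hDt : derived K F ≤ Submodule.span K (Set.range t) ⊔ N :=
    hDS.trans (sup_le hST (hC.trans le_sup_right))
  have := rank_quotient_add_finrank_map_le φ hNR t hDt hr
  rwa [h.map_derived] at this

end IsSurjectiveHom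

end LieSuperalgebra

/-! ### Counting brackets in each case -/

namespace LieSuperalgebra

namespace IsSurjectiveHom

variable {K : Type u} {F : Type w} {L : Type v} [Field K]
  [AddCommGroup F] [Module K F] [LieSuperalgebra K F]
  [AddCommGroup L] [Module K L] [LieSuperalgebra K L] [FiniteDimensional K L] {φ : F →ₗ[K] L}

theorem exists_derived_le_span_union (h : IsSurjectiveHom φ) {B : Set F}
    (hB : B ⊆ derived K F) {d j : ℕ}
    (hd : d ≤ Module.finrank K (Submodule.span K (φ '' B)))
    (hj : Module.finrank K (derived K L) ≤ d + j) :
    ∃ z : Fin j → F, derived K L ≤ Submodule.span K (φ '' (B ∪ Set.range z)) := by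
  have hle : Submodule.span K (φ '' B) ≤ derived K L := by
    rw [← Submodule.map_span, ← h.map_derived]
    exact Submodule.map_mono (Submodule.span_le.mpr hB)
  obtain ⟨t, ht⟩ := Submodule.exists_le_span_sup hle (j := j) (by omega)
  choose z hz using fun i => h.surjective (t i)
  refine ⟨z, ?_⟩
  rwa [Set.image_union, ← Set.range_comp, Submodule.span_union, show φ ∘ z = t from funext hz]

/-- Two odd generators `y`, `z` with `[y, [y, z]] ≠ 0`: `dim M(L) + dim L² ≤ 8`. -/
theorem rank_multiplier_le_of_odd_odd (h : IsSurjectiveHom φ) (hnil : IsNilpotent K L)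
    (h2 : (2 : K) ≠ 0) (h3 : (3 : K) ≠ 0) {y z : F}
    (hy : y ∈ grade (K := K) (L := F) 1) (hz : z ∈ grade (K := K) (L := F) 1)
    (hgen : ∀ a : L, a ∈ Submodule.span K {φ y, φ z} ⊔ derived K L)
    (hder : Module.finrank K (derived K L) = 4)
    (hp : φ (bracket (K := K) y (bracket (K := K) y z)) ≠ 0)
    {r : ℕ} (hr : Module.rank K (↥(LinearMap.ker φ ⊓ derived K F) ⧸
      (bracketSpan K F (LinearMap.ker φ) ⊤).submoduleOf (LinearMap.ker φ ⊓ derived K F)) = r) :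
    r + 4 ≤ 8 := by
  set N := bracketSpan K F (LinearMap.ker φ) ⊤ with hN
  set a₁ := bracket (K := K) y y with ha₁
  set a₂ := bracket (K := K) y z with ha₂
  set a₃ := bracket (K := K) z z with ha₃
  set p := bracket (K := K) y a₂ with hp'
  set q := bracket (K := K) z a₂ with hq'
  have hzy : bracket (K := K) z y = a₂ := bracket_odd_symm hz hy
  have hya₁ : bracket (K := K) y a₁ = 0 := bracket_odd_self_self h3 hy
  have hza₁ : bracket (K := K) z a₁ = (-2 : K) • p := bracket_odd_odd_self hy
  have hya₃ : bracket (K := K) y a₃ = (-2 : K) • q := by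
    rw [bracket_odd_odd_self hz, hzy]
  have hza₃ : bracket (K := K) z a₃ = 0 := bracket_odd_self_self h3 hz
  -- In a relation `s a₁ + t a₂ = 0` in `L`, bracketing with `y` leaves `t p = 0`; then bracketing
  -- with `z` leaves `-2 s p = 0`.
  have hli : LinearIndependent K ![φ a₁, φ a₂] := by
    rw [LinearIndependent.pair_iff]
    intro s t hst
    replace hst : φ (s • a₁ + t • a₂) = 0 := by rw [φ.map_add, φ.map_smul, φ.map_smul, hst]
    have h₁ : φ (bracket (K := K) y (s • a₁ + t • a₂)) = 0 := by
      rw [h.map_bracket, hst, map_zero]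
    rw [map_add, map_smul, map_smul, hya₁, smul_zero, zero_add, map_smul] at h₁
    have ht := (smul_eq_zero.mp h₁).resolve_right hp
    have h₂ : φ (bracket (K := K) z (s • a₁ + t • a₂)) = 0 := by
      rw [h.map_bracket, hst, map_zero]
    rw [ht, zero_smul, add_zero, map_smul, hza₁, map_smul, map_smul] at h₂
    refine ⟨(smul_eq_zero.mp h₂).resolve_right fun h₀ => ?_, ht⟩
    exact hp ((smul_eq_zero.mp h₀).resolve_left (neg_ne_zero.mpr h2))
  have hrank₂ : 2 = Module.finrank K (Submodule.span K {φ a₁, φ a₂}) := by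
    have := finrank_span_eq_card hli
    rwa [Fintype.card_fin, Matrix.range_cons, Matrix.range_cons, Matrix.range_empty,
      Set.union_empty, Set.singleton_union, eq_comm] at this
  have himage : φ '' {a₁, a₂, a₃} = {φ a₁, φ a₂, φ a₃} := by
    rw [Set.image_insert_eq, Set.image_pair]
  have hle : Submodule.span K {φ a₁, φ a₂} ≤ Submodule.span K (φ '' {a₁, a₂, a₃}) := by
    rw [himage]
    refine Submodule.span_mono ?_
    rintro a (rfl | rfl) <;> simp
  have hfin : FiniteDimensional K (Submodule.span K (φ '' {a₁, a₂, a₃})) := inferInstance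
  have hBD : ({a₁, a₂, a₃} : Set F) ⊆ derived K F := by
    rintro a (rfl | rfl | rfl) <;> exact bracket_mem_derived _ _
  -- Brackets of `y`, `z` with `a₁, a₂, a₃` are multiples of `p` or `q`. So only `a₁, a₂, a₃, p, q`
  -- and the brackets with the extra elements `x i` need to be covered.
  have main : ∀ {c j : ℕ} (t : Fin c → F) (x : Fin j → F),
      derived K L ≤ Submodule.span K (φ '' ({a₁, a₂, a₃} ∪ Set.range x)) →
      (∀ a ∈ ({a₁, a₂, a₃, p, q} : Set F), a ∈ Submodule.span K (Set.range t) ⊔ N) →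
      (∀ i, bracket (K := K) y (x i) ∈ Submodule.span K (Set.range t)) →
      (∀ i, bracket (K := K) z (x i) ∈ Submodule.span K (Set.range t)) → r + 4 ≤ c := by
    intro c j t x hx ht hyx hzx
    rw [← hder]
    refine h.rank_multiplier_add_finrank_derived_le hnil (A := {y, z})
      (by rwa [Set.image_pair]) hx t ?_ ?_ hr
    · rintro a (rfl | rfl) b (rfl | rfl)
      · exact ht _ (by simp [ha₁])
      · exact ht _ (by simp [ha₂])
      · exact ht _ (by simp [hzy])
      · exact ht _ (by simp [ha₃])
    · rintro a (rfl | rfl) b ((rfl | rfl | rfl) | ⟨i, rfl⟩)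
      · simp [hya₁]
      · exact ht _ (by simp [hp'])
      · rw [hya₃]
        exact Submodule.smul_mem _ _ (ht _ (by simp))
      · exact Submodule.mem_sup_left (hyx i)
      · rw [hza₁]
        exact Submodule.smul_mem _ _ (ht _ (by simp))
      · exact ht _ (by simp [hq'])
      · simp [hza₃]
      · exact Submodule.mem_sup_left (hzx i)
  -- If `a₃` is dependent in `L`, two extra elements complete `L²` but `q` becomes redundant: `4 + 4
  -- = 8`. Otherwise one extra element suffices: `5 + 2 = 7`.
  by_cases hmem : φ a₃ ∈ Submodule.span K {φ a₁, φ a₂}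
  · obtain ⟨x, hx⟩ := h.exists_derived_le_span_union hBD (d := 2) (j := 2)
      (hrank₂.trans_le (Submodule.finrank_mono hle)) (by omega)
    refine main ![a₁, a₂, a₃, p, bracket (K := K) y (x 0), bracket (K := K) y (x 1),
      bracket (K := K) z (x 0), bracket (K := K) z (x 1)] x hx ?_ ?_ ?_
    · rintro a (rfl | rfl | rfl | rfl | rfl)
      · exact Submodule.mem_sup_left (Submodule.subset_span ⟨0, rfl⟩)
      · exact Submodule.mem_sup_left (Submodule.subset_span ⟨1, rfl⟩)
      · exact Submodule.mem_sup_left (Submodule.subset_span ⟨2, rfl⟩)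
      · exact Submodule.mem_sup_left (Submodule.subset_span ⟨3, rfl⟩)
      · obtain ⟨α, β, hαβ⟩ := Submodule.mem_span_pair.mp hmem
        have hrel : φ (α • a₁ + β • a₂ - a₃) = 0 := by
          rw [map_sub, map_add, map_smul, map_smul, hαβ, sub_self]
        have hN' := h.bracket_ker_right y hrel
        rw [map_sub, map_add, map_smul, map_smul, hya₁, hya₃, smul_zero, zero_add] at hN'
        -- Bracketing `y` with the relation `α a₁ + β a₂ - a₃ ∈ R` gives `β p + 2 q ∈ [R, F]`, which
        -- is solved for `q`.
        have hq : q = (2⁻¹ : K) • (β • p - (-2 : K) • q) + (-(2⁻¹ * β) : K) • p := by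
          have : (2⁻¹ * 2 : K) = 1 := inv_mul_cancel₀ h2
          linear_combination (norm := module) (-this) • q
        rw [hq]
        exact add_mem (Submodule.mem_sup_right (Submodule.smul_mem _ _ hN'))
          (Submodule.mem_sup_left (Submodule.smul_mem _ _ (Submodule.subset_span ⟨3, rfl⟩)))
    · intro i
      fin_cases i
      · exact Submodule.subset_span ⟨4, rfl⟩
      · exact Submodule.subset_span ⟨5, rfl⟩
    · intro i
      fin_cases i
      · exact Submodule.subset_span ⟨6, rfl⟩
      · exact Submodule.subset_span ⟨7, rfl⟩
  · have hlt : Submodule.span K {φ a₁, φ a₂} < Submodule.span K (φ '' {a₁, a₂, a₃}) := by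
      refine lt_of_le_of_ne hle fun heq => hmem ?_
      rw [heq, himage]
      exact Submodule.subset_span (by simp)
    have hrank₃ := Submodule.finrank_lt_finrank_of_lt hlt
    obtain ⟨x, hx⟩ := h.exists_derived_le_span_union hBD (d := 3) (j := 1) (by omega) (by omega)
    refine (main ![a₁, a₂, a₃, p, q, bracket (K := K) y (x 0), bracket (K := K) z (x 0)]
      x hx ?_ ?_ ?_).trans (by omega)
    · rintro a (rfl | rfl | rfl | rfl | rfl)
      · exact Submodule.mem_sup_left (Submodule.subset_span ⟨0, rfl⟩)
      · exact Submodule.mem_sup_left (Submodule.subset_span ⟨1, rfl⟩)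
      · exact Submodule.mem_sup_left (Submodule.subset_span ⟨2, rfl⟩)
      · exact Submodule.mem_sup_left (Submodule.subset_span ⟨3, rfl⟩)
      · exact Submodule.mem_sup_left (Submodule.subset_span ⟨4, rfl⟩)
    · intro i
      fin_cases i
      exact Submodule.subset_span ⟨5, rfl⟩
    · intro i
      fin_cases i
      exact Submodule.subset_span ⟨6, rfl⟩

/-- An even generator `x` and an odd generator `y` with `[y, y] = 0`:
`dim M(L) + dim L² ≤ 9`. -/
theorem rank_multiplier_le_of_even_odd_of_eq_zero (h : IsSurjectiveHom φ) (hnil : IsNilpotent K L)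
    (h2 : (2 : K) ≠ 0) {x y : F}
    (hx : x ∈ grade (K := K) (L := F) 0) (hy : y ∈ grade (K := K) (L := F) 1)
    (hgen : ∀ a : L, a ∈ Submodule.span K {φ x, φ y} ⊔ derived K L)
    (hder : Module.finrank K (derived K L) = 4)
    (hw : φ (bracket (K := K) x y) ≠ 0) (hyy : φ (bracket (K := K) y y) = 0)
    {r : ℕ} (hr : Module.rank K (↥(LinearMap.ker φ ⊓ derived K F) ⧸
      (bracketSpan K F (LinearMap.ker φ) ⊤).submoduleOf (LinearMap.ker φ ⊓ derived K F)) = r) :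
    r + 4 ≤ 9 := by
  set N := bracketSpan K F (LinearMap.ker φ) ⊤ with hN
  set w := bracket (K := K) x y with hw'
  have hyx : bracket (K := K) y x = -w := by
    rw [hw', bracket_even_skew hx, neg_neg]
  -- `[y, y] ∈ R`, so `2 [y, w] = [x, [y, y]]` lies in `[R, F]`. This removes one of the ten
  -- candidate brackets.
  have hyw : bracket (K := K) y w ∈ N := by
    have hN' := h.bracket_ker_right x hyy
    rw [bracket_even_odd_self hx hy] at hN'
    exact (Submodule.smul_mem_iff _ h2).mp hN'
  obtain ⟨z, hz⟩ := h.exists_derived_le_span_union (B := {w}) (d := 1) (j := 3)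
    (by rintro a rfl; exact bracket_mem_derived _ _)
    (by rw [Set.image_singleton, finrank_span_singleton hw]) (by omega)
  rw [← hder]
  refine h.rank_multiplier_add_finrank_derived_le hnil (A := {x, y})
    (by rwa [Set.image_pair]) hz ![w, bracket (K := K) y y, bracket (K := K) x w,
      bracket (K := K) x (z 0), bracket (K := K) x (z 1), bracket (K := K) x (z 2),
      bracket (K := K) y (z 0), bracket (K := K) y (z 1), bracket (K := K) y (z 2)] ?_ ?_ hr
  · rintro a (rfl | rfl) b (rfl | rfl)
    · simp [bracket_even_self h2 hx]
    · exact Submodule.mem_sup_left (Submodule.subset_span ⟨0, rfl⟩)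
    · rw [hyx]
      exact neg_mem (Submodule.mem_sup_left (Submodule.subset_span ⟨0, rfl⟩))
    · exact Submodule.mem_sup_left (Submodule.subset_span ⟨1, rfl⟩)
  · rintro a (rfl | rfl) b (rfl | ⟨i, rfl⟩)
    · exact Submodule.mem_sup_left (Submodule.subset_span ⟨2, rfl⟩)
    · fin_cases i
      · exact Submodule.mem_sup_left (Submodule.subset_span ⟨3, rfl⟩)
      · exact Submodule.mem_sup_left (Submodule.subset_span ⟨4, rfl⟩)
      · exact Submodule.mem_sup_left (Submodule.subset_span ⟨5, rfl⟩)
    · exact Submodule.mem_sup_right hyw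
    · fin_cases i
      · exact Submodule.mem_sup_left (Submodule.subset_span ⟨6, rfl⟩)
      · exact Submodule.mem_sup_left (Submodule.subset_span ⟨7, rfl⟩)
      · exact Submodule.mem_sup_left (Submodule.subset_span ⟨8, rfl⟩)

/-- An even generator `x` and an odd generator `y` with `[y, y] ≠ 0`:
`dim M(L) + dim L² ≤ 8`. -/
theorem rank_multiplier_le_of_even_odd_of_ne_zero (h : IsSurjectiveHom φ) (hnil : IsNilpotent K L)
    (h2 : (2 : K) ≠ 0) (h3 : (3 : K) ≠ 0) {x y : F}
    (hx : x ∈ grade (K := K) (L := F) 0) (hy : y ∈ grade (K := K) (L := F) 1)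
    (hgen : ∀ a : L, a ∈ Submodule.span K {φ x, φ y} ⊔ derived K L)
    (hder : Module.finrank K (derived K L) = 4)
    (hw : φ (bracket (K := K) x y) ≠ 0) (hyy : φ (bracket (K := K) y y) ≠ 0)
    {r : ℕ} (hr : Module.rank K (↥(LinearMap.ker φ ⊓ derived K F) ⧸
      (bracketSpan K F (LinearMap.ker φ) ⊤).submoduleOf (LinearMap.ker φ ⊓ derived K F)) = r) :
    r + 4 ≤ 8 := by
  set N := bracketSpan K F (LinearMap.ker φ) ⊤ with hN
  set w := bracket (K := K) x y with hw'
  set a₁ := bracket (K := K) y y with ha₁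
  have hyx : bracket (K := K) y x = -w := by
    rw [hw', bracket_even_skew hx, neg_neg]
  have hwo : φ w ∈ grade (K := K) (L := L) 1 := h.map_grade (bracket_mem_even_odd hx hy)
  have hae : φ a₁ ∈ grade (K := K) (L := L) 0 := h.map_grade (bracket_mem_odd_odd hy hy)
  have hdis := (isCompl_grade (K := K) (L := L)).disjoint
  rw [Submodule.disjoint_def] at hdis
  -- Nonzero elements of opposite parity: `w` is odd, `a₁` is even.
  have hli : LinearIndependent K ![φ w, φ a₁] := by
    rw [LinearIndependent.pair_iff]
    intro s t hst
    have h₁ : t • φ a₁ = 0 := by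
      refine hdis _ (Submodule.smul_mem _ _ hae) ?_
      rw [eq_neg_of_add_eq_zero_right hst]
      exact neg_mem (Submodule.smul_mem _ _ hwo)
    rw [h₁, add_zero] at hst
    exact ⟨(smul_eq_zero.mp hst).resolve_right hw, (smul_eq_zero.mp h₁).resolve_right hyy⟩
  have hrank₂ : 2 = Module.finrank K (Submodule.span K {φ w, φ a₁}) := by
    have := finrank_span_eq_card hli
    rwa [Fintype.card_fin, Matrix.range_cons, Matrix.range_cons, Matrix.range_empty,
      Set.union_empty, Set.singleton_union, eq_comm] at this
  obtain ⟨z, hz⟩ := h.exists_derived_le_span_union (B := {w, a₁}) (d := 2) (j := 2)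
    (by rintro a (rfl | rfl) <;> exact bracket_mem_derived _ _)
    (by rw [Set.image_pair]; exact hrank₂.le) (by omega)
  rw [← hder]
  -- Eight brackets suffice because `[x, a₁] = 2 [y, w]` and `[y, a₁] = 0`.
  refine h.rank_multiplier_add_finrank_derived_le hnil (A := {x, y})
    (by rwa [Set.image_pair]) hz ![w, a₁, bracket (K := K) x w, bracket (K := K) y w,
      bracket (K := K) x (z 0), bracket (K := K) x (z 1),
      bracket (K := K) y (z 0), bracket (K := K) y (z 1)] ?_ ?_ hr
  · rintro a (rfl | rfl) b (rfl | rfl)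
    · simp [bracket_even_self h2 hx]
    · exact Submodule.mem_sup_left (Submodule.subset_span ⟨0, rfl⟩)
    · rw [hyx]
      exact neg_mem (Submodule.mem_sup_left (Submodule.subset_span ⟨0, rfl⟩))
    · exact Submodule.mem_sup_left (Submodule.subset_span ⟨1, rfl⟩)
  · rintro a (rfl | rfl) b ((rfl | rfl) | ⟨i, rfl⟩)
    · exact Submodule.mem_sup_left (Submodule.subset_span ⟨2, rfl⟩)
    · rw [bracket_even_odd_self hx hy]
      exact Submodule.smul_mem _ _ (Submodule.mem_sup_left (Submodule.subset_span ⟨3, rfl⟩))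
    · fin_cases i
      · exact Submodule.mem_sup_left (Submodule.subset_span ⟨4, rfl⟩)
      · exact Submodule.mem_sup_left (Submodule.subset_span ⟨5, rfl⟩)
    · exact Submodule.mem_sup_left (Submodule.subset_span ⟨3, rfl⟩)
    · simp [ha₁, bracket_odd_self_self h3 hy]
    · fin_cases i
      · exact Submodule.mem_sup_left (Submodule.subset_span ⟨6, rfl⟩)
      · exact Submodule.mem_sup_left (Submodule.subset_span ⟨7, rfl⟩)

/-- An even generator and an odd generator, with `L²` having an odd part of dimension at most
one: `dim M(L) + dim L² ≤ 7`. -/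
theorem rank_multiplier_le_of_finrank_odd_derived_le_one (h : IsSurjectiveHom φ)
    (hnil : IsNilpotent K L) (h2 : (2 : K) ≠ 0) (h3 : (3 : K) ≠ 0) {x y : F}
    (hx : x ∈ grade (K := K) (L := F) 0) (hy : y ∈ grade (K := K) (L := F) 1)
    (hgen : ∀ a : L, a ∈ Submodule.span K {φ x, φ y} ⊔ derived K L)
    (hodd : Module.finrank K ↥(grade (K := K) (L := L) 1 ⊓ derived K L) ≤ 1)
    {r : ℕ} (hr : Module.rank K (↥(LinearMap.ker φ ⊓ derived K F) ⧸
      (bracketSpan K F (LinearMap.ker φ) ⊤).submoduleOf (LinearMap.ker φ ⊓ derived K F)) = r) :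
    r + Module.finrank K (derived K L) ≤ 7 := by
  set N := bracketSpan K F (LinearMap.ker φ) ⊤ with hN
  set w := bracket (K := K) x y with hw
  set a₁ := bracket (K := K) y y with ha₁
  set b₁ := bracket (K := K) y w with hb₁
  set c₁ := bracket (K := K) w w with hc₁
  have hyx : bracket (K := K) y x = -w := by
    rw [hw, bracket_even_skew hx, neg_neg]
  obtain ⟨hxw, hD⟩ := hnil.derived_le_of_finrank_odd_derived_le_one h2 h3 (h.map_grade hx)
    (h.map_grade hy) hgen hodd (h.map_bracket x y).symm
  simp only [← h.map_bracket] at hxw hD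
  -- Beyond the explicit list, `[x, a₁] = 2 b₁`, `[y, a₁] = 0`, and `[x, c₁] = 2 [w, [x, w]]` lies
  -- in `[R, F]` because `[x, w] ∈ R`.
  refine h.rank_multiplier_add_finrank_derived_le hnil (A := {x, y}) (B := {w, a₁, b₁, c₁})
    (by rwa [Set.image_pair]) (by rwa [Set.image_insert_eq, Set.image_insert_eq, Set.image_pair])
    ![w, a₁, b₁, bracket (K := K) x w, bracket (K := K) x b₁, bracket (K := K) y b₁,
      bracket (K := K) y c₁] ?_ ?_ hr
  · rintro a (rfl | rfl) b (rfl | rfl)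
    · simp [bracket_even_self h2 hx]
    · exact Submodule.mem_sup_left (Submodule.subset_span ⟨0, rfl⟩)
    · rw [hyx]
      exact neg_mem (Submodule.mem_sup_left (Submodule.subset_span ⟨0, rfl⟩))
    · exact Submodule.mem_sup_left (Submodule.subset_span ⟨1, rfl⟩)
  · rintro a (rfl | rfl) b (rfl | rfl | rfl | rfl)
    · exact Submodule.mem_sup_left (Submodule.subset_span ⟨3, rfl⟩)
    · rw [bracket_even_odd_self hx hy]
      exact Submodule.smul_mem _ _ (Submodule.mem_sup_left (Submodule.subset_span ⟨2, rfl⟩))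
    · exact Submodule.mem_sup_left (Submodule.subset_span ⟨4, rfl⟩)
    · rw [hc₁, bracket_even_odd_self hx (bracket_mem_even_odd hx hy)]
      exact Submodule.smul_mem _ _ (Submodule.mem_sup_right (h.bracket_ker_right _ hxw))
    · exact Submodule.mem_sup_left (Submodule.subset_span ⟨2, rfl⟩)
    · simp [ha₁, bracket_odd_self_self h3 hy]
    · exact Submodule.mem_sup_left (Submodule.subset_span ⟨5, rfl⟩)
    · exact Submodule.mem_sup_left (Submodule.subset_span ⟨6, rfl⟩)

theorem rank_multiplier_lt_of_even_odd (h : IsSurjectiveHom φ) (hnil : IsNilpotent K L)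
    (h2 : (2 : K) ≠ 0) (h3 : (3 : K) ≠ 0) {x y : L}
    (hx : x ∈ grade (K := K) (L := L) 0) (hy : y ∈ grade (K := K) (L := L) 1)
    (hgen : ∀ a : L, a ∈ Submodule.span K {x, y} ⊔ derived K L)
    (hdim : Module.finrank K L = 6) (hder : Module.finrank K (derived K L) = 4)
    {r : ℕ} (hr : Module.rank K (↥(LinearMap.ker φ ⊓ derived K F) ⧸
      (bracketSpan K F (LinearMap.ker φ) ⊤).submoduleOf (LinearMap.ker φ ⊓ derived K F)) = r) :
    r < Module.finrank K (grade (K := K) (L := L) 1) + 2 := by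
  have hn := finrank_odd_derived_add_one_le hy hgen (by omega)
  have hw := hnil.bracket_even_odd_ne_zero h2 h3 hx hy hgen (by omega)
  have hf := hnil.succ_le_finrank_odd_derived hx
    ⟨bracket_mem_even_odd hx hy, bracket_mem_derived x y⟩ (k := 0) (by simpa using hw)
  obtain ⟨x, hx', rfl⟩ := h.exists_homogeneous_lift hx
  obtain ⟨y, hy', rfl⟩ := h.exists_homogeneous_lift hy
  rw [← h.map_bracket] at hw
  by_cases hyy : φ (bracket (K := K) y y) = 0
  · have h₁ := h.rank_multiplier_le_of_even_odd_of_eq_zero hnil h2 hx' hy' hgen hder hw hyy hr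
    rw [h.map_bracket] at hyy
    have h₃ := hnil.three_le_finrank_odd_derived h2 h3 hx hy hgen
      (by omega) hyy
    omega
  · have h₁ := h.rank_multiplier_le_of_even_odd_of_ne_zero hnil h2 h3 hx' hy' hgen hder hw hyy hr
    by_cases hodd : Module.finrank K ↥(grade (K := K) (L := L) 1 ⊓ derived K L) ≤ 1
    · have h₄ := h.rank_multiplier_le_of_finrank_odd_derived_le_one hnil h2 h3 hx' hy' hgen hodd hr
      omega
    · omega

theorem rank_multiplier_lt_of_odd_odd (h : IsSurjectiveHom φ) (hnil : IsNilpotent K L)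
    (h2 : (2 : K) ≠ 0) (h3 : (3 : K) ≠ 0) {y z : L}
    (hy : y ∈ grade (K := K) (L := L) 1) (hz : z ∈ grade (K := K) (L := L) 1)
    (hgen : ∀ a : L, a ∈ Submodule.span K {y, z} ⊔ derived K L)
    (hdim : Module.finrank K L = 6) (hder : Module.finrank K (derived K L) = 4)
    {r : ℕ} (hr : Module.rank K (↥(LinearMap.ker φ ⊓ derived K F) ⧸
      (bracketSpan K F (LinearMap.ker φ) ⊤).submoduleOf (LinearMap.ker φ ⊓ derived K F)) = r) :
    r < Module.finrank K (grade (K := K) (L := L) 1) + 2 := by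
  -- The two generators play symmetric roles, and one of the two double brackets is nonzero.
  wlog hp : bracket (K := K) y (bracket (K := K) y z) ≠ 0 generalizing y z
  · exact this hz hy (by rwa [Set.pair_comm])
      ((hnil.bracket_odd_odd_ne_zero h3 hy hz hgen (by omega)).resolve_left hp)
  have hn := finrank_odd_derived_add_two_le hy hz hgen (by omega)
  have hf : 1 ≤ Module.finrank K ↥(grade (K := K) (L := L) 1 ⊓ derived K L) := by
    rw [← finrank_span_singleton (K := K) hp]
    refine Submodule.finrank_mono ((Submodule.span_singleton_le_iff_mem _ _).mpr
      ⟨bracket_mem_odd_even hy (bracket_mem_odd_odd hy hz), bracket_mem_derived _ _⟩)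
  obtain ⟨y, hy', rfl⟩ := h.exists_homogeneous_lift hy
  obtain ⟨z, hz', rfl⟩ := h.exists_homogeneous_lift hz
  rw [← h.map_bracket, ← h.map_bracket] at hp
  have := h.rank_multiplier_le_of_odd_odd hnil h2 h3 hy' hz' hgen hder hp hr
  omega

end IsSurjectiveHom

/-! ### Conclusion for free presentations -/

theorem FreePresentation.isSurjectiveHom {K : Type u} {L : Type v} [Field K] [AddCommGroup L]
    [Module K L] [LieSuperalgebra K L] (P : FreePresentation.{u, v, w} K L) :
    IsSurjectiveHom (FreeLieSuper.lift P.toFun P.toFun_mem) where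
  map_bracket := FreeLieSuper.lift_bracket P.toFun P.toFun_mem
  map_grade := FreeLieSuper.lift_mem_grade P.toFun_mem
  surjective := P.surjective

end LieSuperalgebra

theorem proposition2p4 {K : Type u} [Field K] (hK2 : ringChar K ≠ 2) (hK3 : ringChar K ≠ 3)
    {L : Type v} [AddCommGroup L] [Module K L] [LieSuperalgebra K L]
    (m n : ℕ) (hmn : m + n = 6) (hn : 1 ≤ n)
    (hdim : LieSuperalgebra.HasSuperdim K L m n)
    (hnil : LieSuperalgebra.IsNilpotent K L)
    (hder : Module.finrank K (LieSuperalgebra.derived K L) = 4)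
    (P : LieSuperalgebra.FreePresentation.{u, v, w} K L) :
    Module.rank K P.SchurMultiplier ≠ ((m + 2 * n - 4 : ℕ) : Cardinal) := by
  intro hr
  have h2 : (2 : K) ≠ 0 := Ring.two_ne_zero hK2
  have h3 : (3 : K) ≠ 0 := by
    intro h
    have hd : ringChar K ∣ 3 := (ringChar.spec K 3).mp (by exact_mod_cast h)
    rcases (Nat.dvd_prime Nat.prime_three).mp hd with h1 | h1
    · exact CharP.ringChar_ne_one h1
    · exact hK3 h1
  obtain ⟨hfin, hm, rfl⟩ := hdim
  have hsum := Submodule.finrank_add_eq_of_isCompl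
    (LieSuperalgebra.isCompl_grade (K := K) (L := L))
  have hφ := P.isSurjectiveHom
  obtain ⟨i, j, x, y, hx, hy, hgen⟩ :=
    LieSuperalgebra.exists_homogeneous_generators (K := K) (L := L) (by omega)
  have h01 : ∀ i : ZMod 2, i = 0 ∨ i = 1 := by decide
  -- Cases on the parities of the generators; in the last three, `m + 2 n - 4 = n + 2` contradicts
  -- the strict bound.
  rcases h01 i with rfl | rfl <;> rcases h01 j with rfl | rfl
  · rw [hnil.grade_one_eq_bot hx hy hgen, finrank_bot] at hn
    omega
  · have := hφ.rank_multiplier_lt_of_even_odd hnil h2 h3 hx hy hgen (by omega) hder hr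
    omega
  · have := hφ.rank_multiplier_lt_of_even_odd hnil h2 h3 hy hx (by rwa [Set.pair_comm])
      (by omega) hder hr
    omega
  · have := hφ.rank_multiplier_lt_of_odd_odd hnil h2 h3 hx hy hgen (by omega) hder hr
    omega
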